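/- Let $\mathbb T=\mathbb R/\mathbb Z$ with normalized Lebesgue measure $dt$, and write $|t|$ for the distance from $t\in\mathbb T$ to $0$. Let $(\omega_n)_{n\ge1}$ be independent random variables, uniformly distributed on $\mathbb T$, on a probability space, and let $(\ell_n)_{n\ge1}$ be a non-increasing sequence in $(0,1)$ with $\ell_n\to0$. Put $$P_n(t)=\frac{1-\mathbf 1_{(0,\ell_n)}(t-\omega_n)}{1-\ell_n},\qquad t\in\mathbb T,$$ where $(0,\ell_n)$ is regarded as an arc of $\mathbb T$, let $M_n=\prod_{k=1}^nP_k$ and $\mu_n(dt)=M_n(t)\,dt$, and let $K(t)=\exp\big(\sum_{n\ge1}(\ell_n-|t|)_+\big)\in[1,\infty]$. Assume (A) $\sum_{n\ge1}\ell_n=\infty$, (B) $\sum_{n\ge1}(\ell_n-\ell_{n+1})\exp\big(\sum_{k=1}^n\ell_k\big)<\infty$, and that for some integer $d\ge1$ $$\int_{\mathbb T^d}K(t_1)\cdots K(t_d)\,K\Big(-\sum_{i=1}^dt_i\Big)\,dt_1\cdots dt_d<\infty .$$ Then, almost surely, the measures $\mu_n$ converge weakly to a finite measure $\mu_D$ on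 $\mathbb T$ (the Dvoretzky measure), and $\mu_D*\mu_D*\cdots*\mu_D$, with $d$ convolution signs (that is, $d+1$ factors), is absolutely continuous with respect to Lebesgue measure. -/

import Mathlib

open MeasureTheory ProbabilityTheory Filter Topology
open scoped ENNReal

namespace DvoretzkyCovering

/-- The image on the circle `ℝ / ℤ` of the open interval `(0, r)`. -/
def arc (r : ℝ) : Set UnitAddCircle :=
  (fun x : ℝ => (x : UnitAddCircle)) '' Set.Ioo 0 r

/-- The factor attached to a covering arc of length `r` starting at `w`:
`(1 - 𝟙_{(0, r)}(t - w)) / (1 - r)`, where `t - w` is taken on the circle. -/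
noncomputable def factor (r : ℝ) (w t : UnitAddCircle) : ℝ :=
  (1 - (arc r).indicator (fun _ => (1 : ℝ)) (t - w)) / (1 - r)

/-- The product of the factors of the first `n` arcs. -/
noncomputable def density (ℓ : ℕ → ℝ) (w : ℕ → UnitAddCircle) (n : ℕ)
    (t : UnitAddCircle) : ℝ :=
  ∏ k ∈ Finset.range n, factor (ℓ k) (w k) t

theorem abs_factor_le (r : ℝ) (w t : UnitAddCircle) : |factor r w t| ≤ |1 - r|⁻¹ := by
  unfold factor
  rw [abs_div, div_eq_mul_inv]
  refine mul_le_of_le_one_left (by positivity) ?_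
  by_cases h : t - w ∈ arc r <;> simp [h]

theorem hasFiniteIntegral_density (ℓ : ℕ → ℝ) (w : ℕ → UnitAddCircle) (n : ℕ) :
    HasFiniteIntegral (density ℓ w n) (volume : Measure UnitAddCircle) := by
  refine HasFiniteIntegral.of_bounded (C := ∏ k ∈ Finset.range n, |1 - ℓ k|⁻¹)
    (Eventually.of_forall fun t => ?_)
  rw [Real.norm_eq_abs, density, Finset.abs_prod]
  exact Finset.prod_le_prod (fun _ _ => abs_nonneg _) (fun k _ => abs_factor_le _ _ _)

/-- The finite measure on the circle with density `density ℓ w n` with respect to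
Lebesgue measure. -/
noncomputable def partialMeasure (ℓ : ℕ → ℝ) (w : ℕ → UnitAddCircle) (n : ℕ) :
    FiniteMeasure UnitAddCircle :=
  ⟨volume.withDensity (fun t => ENNReal.ofReal (density ℓ w n t)),
    isFiniteMeasure_withDensity_ofReal (hasFiniteIntegral_density ℓ w n)⟩

/-- The Dvoretzky measure for the lengths `ℓ` and the left endpoints `w`: the limit of the
measures `partialMeasure ℓ w n` for the topology of weak convergence of finite measures
(it is meaningful only when this limit exists; the limit is then unique). -/
noncomputable def dvoretzkyMeasure (ℓ : ℕ → ℝ) (w : ℕ → UnitAddCircle) :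
    FiniteMeasure UnitAddCircle :=
  limUnder atTop (partialMeasure ℓ w)

/-- The kernel `K(t) = exp (∑ₙ (ℓₙ - |t|)₊)` on the circle, with values in `[0, ∞]`; here
`‖t‖` is the distance from `t` to `0` on the circle, that is `|t|` for `|t| ≤ 1/2`. -/
noncomputable def kernel (ℓ : ℕ → ℝ) (t : UnitAddCircle) : ℝ≥0∞ :=
  EReal.exp ((∑' n, ENNReal.ofReal (ℓ n - ‖t‖) : ℝ≥0∞) : EReal)

/-- The result of convolving `μ` with itself `d` times, `μ ∗ μ ∗ ⋯ ∗ μ` with `d` convolution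
signs, hence `d + 1` factors. -/
noncomputable def iteratedConv (μ : Measure UnitAddCircle) : ℕ → Measure UnitAddCircle
  | 0 => μ
  | d + 1 => Measure.conv (iteratedConv μ d) μ

end DvoretzkyCovering

open scoped NNReal

namespace DvoretzkyCovering

/-! For a fixed continuous `f`, the integrals ∫ f dμ_n form a martingale bounded in L¹: each factor
has mean 1 and is independent of the earlier ones. They converge almost surely for `f` in a
countable dense family, and compactness of mass-bounded measures on the circle turns this into weak
convergence (`ae_tendsto_partialMeasure`).

Absolute continuity is a second moment argument. An arc of length r ≤ 1/2 avoids both t and s with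
probability at most 1 - 2r + (r - |t-s|)₊; after normalization by (1-r)⁻² it contributes at most
exp((r - |t-s|)₊ + 2r²), and the errors r² are summable because (B) forces ∑ ℓ_n² < ∞. If d+1 pairs
(t_i, s_i) lie in well-separated balls, a short arc can meet only one ball, so E ∏ M_n(t_i) M_n(s_i)
≤ C ∏ K(t_i - s_i) uniformly in n (`exists_lintegral_prod_density_le`).

Cut the (d+1)-fold product of μ_n down to such a box by a continuous weight, and let h_n be the
density of the resulting law of the sum. In E ∫ h_n² the two tuples have the same sum, so their
differences add up to 0 and the bound becomes exactly the integral assumed finite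
(`lintegral_sq_sumDensity_le`). Fatou and Cauchy–Schwarz then give (∫ g dλ)² ≤ C ∫ g dt for the
limit law λ and all continuous 0 ≤ g ≤ 1, which forces λ ≪ dt.

Countably many boxes cover all tuples with distinct coordinates. The remaining tuples lie on
diagonals, which are null because μ_D has no atoms: K is integrable, and the two-point bound
controls the mass near the diagonal (`ae_measure_singleton_eq_zero`). -/

instance : IsProbabilityMeasure (volume : Measure UnitAddCircle) :=
  ⟨UnitAddCircle.measure_univ⟩

/-! ### Arcs on the circle and the positions from which they cover given points -/

theorem isOpen_coe_image {S : Set ℝ} (hS : IsOpen S) :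
    IsOpen ((fun x : ℝ => (x : UnitAddCircle)) '' S) :=
  QuotientAddGroup.isOpenMap_coe S hS

theorem isOpen_arc (r : ℝ) : IsOpen (arc r) := isOpen_coe_image isOpen_Ioo

theorem volume_coe_image {S : Set ℝ} (hS : IsOpen S) (hS' : S ⊆ Set.Ioc 0 1) :
    volume ((fun x : ℝ => (x : UnitAddCircle)) '' S) = volume S := by
  have h := AddCircle.add_projection_respects_measure (T := 1) 0
    (isOpen_coe_image hS).measurableSet
  refine h.trans (congrArg _ ?_)
  ext x
  constructor
  · rintro ⟨⟨y, hy, hxy⟩, hx⟩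
    have hy' := hS' hy
    have := (AddCircle.coe_eq_coe_iff_of_mem_Ioc (p := (1 : ℝ)) (a := 0) (by simpa using hy')
      (by simpa using hx)).1 hxy
    exact this ▸ hy
  · intro hx
    exact ⟨⟨x, hx, rfl⟩, by simpa using hS' hx⟩

/-- The positions `w` of the left endpoint for which the arc of length `r` covers `t`. -/
def hitSet (r : ℝ) (t : UnitAddCircle) : Set UnitAddCircle := {w | t - w ∈ arc r}

theorem isOpen_hitSet (r : ℝ) (t : UnitAddCircle) : IsOpen (hitSet r t) :=
  (isOpen_arc r).preimage (by fun_prop)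

theorem measurableSet_hitSet (r : ℝ) (t : UnitAddCircle) : MeasurableSet (hitSet r t) :=
  (isOpen_hitSet r t).measurableSet

theorem volume_hitSet {r : ℝ} (hr1 : r ≤ 1) (t : UnitAddCircle) :
    volume (hitSet r t) = ENNReal.ofReal r := by
  have h := (Measure.measurePreserving_sub_left (volume : Measure UnitAddCircle) t).measure_preimage
    (isOpen_arc r).measurableSet.nullMeasurableSet
  refine h.trans ?_
  rw [arc, volume_coe_image isOpen_Ioo fun x hx => ⟨hx.1, hx.2.le.trans hr1⟩, Real.volume_Ioo,
    sub_zero]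

theorem hitSet_subset_ball (r : ℝ) (t : UnitAddCircle) : hitSet r t ⊆ Metric.ball t r := by
  rintro w ⟨x, hx, hxw⟩
  rw [Metric.mem_ball, dist_comm, dist_eq_norm, ← hxw]
  refine lt_of_le_of_lt (QuotientAddGroup.norm_mk_le_norm (S := AddSubgroup.zmultiples (1 : ℝ)) (m := x)) ?_
  rw [Real.norm_eq_abs, abs_of_pos hx.1]
  exact hx.2

/-- In the coordinate y = s - w the two hit sets contain the images of (0, r) and (x, x + r). As r
and x are at most 1/2, both intervals lie in (0, 1], so nothing wraps around and the length can be
computed on the line. -/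
theorem le_volume_hitSet_union_of_coe {r x : ℝ} (hr0 : 0 < r) (hr : r ≤ 1 / 2) (hx0 : 0 ≤ x)
    (hx : x ≤ 1 / 2) {s t : UnitAddCircle} (hst : s - t = (x : UnitAddCircle)) :
    ENNReal.ofReal (r + min r x) ≤ volume (hitSet r t ∪ hitSet r s) := by
  set S : Set ℝ := Set.Ioo 0 r ∪ Set.Ioo x (x + r) with hS
  have hSo : IsOpen S := isOpen_Ioo.union isOpen_Ioo
  have hS1 : S ⊆ Set.Ioc 0 1 := by
    rintro y (hy | hy)
    · exact ⟨hy.1, by linarith [hy.2]⟩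
    · exact ⟨by linarith [hy.1], by linarith [hy.2]⟩
  have h := (Measure.measurePreserving_sub_left (volume : Measure UnitAddCircle) s).measure_preimage
    (isOpen_coe_image hSo).measurableSet.nullMeasurableSet
  rw [volume_coe_image hSo hS1] at h
  have hsub : (fun w => s - w) ⁻¹' ((fun x : ℝ => (x : UnitAddCircle)) '' S)
      ⊆ hitSet r t ∪ hitSet r s := by
    rintro w ⟨y, hy | hy, hyw⟩
    · exact Or.inr ⟨y, hy, hyw⟩
    · refine Or.inl ⟨y - x, ⟨by linarith [hy.1], by linarith [hy.2]⟩, ?_⟩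
      have h2 : (y : UnitAddCircle) = s - w := hyw
      change ((y - x : ℝ) : UnitAddCircle) = t - w
      rw [AddCircle.coe_sub, h2, ← hst]
      abel
  refine le_trans ?_ ((h.symm.le).trans (measure_mono hsub))
  -- Shortening the first interval to (0, min r x) makes the two disjoint without changing the
  -- length of the union.
  have hd : Disjoint (Set.Ioo 0 (min r x)) (Set.Ioo x (x + r)) := by
    rw [Set.disjoint_left]
    rintro y hy hy'
    exact absurd (hy.2.trans_le (min_le_right _ _)) (not_lt.2 hy'.1.le)
  calc ENNReal.ofReal (r + min r x)
      = volume (Set.Ioo 0 (min r x) ∪ Set.Ioo x (x + r)) := by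
        rw [measure_union hd measurableSet_Ioo, Real.volume_Ioo, Real.volume_Ioo,
          ← ENNReal.ofReal_add (by simp [hr0.le, hx0]) (by linarith)]
        congr 1; ring
    _ ≤ volume S := measure_mono (Set.union_subset_union_left _
        (Set.Ioo_subset_Ioo_right (min_le_left _ _)))

theorem le_volume_hitSet_union {r : ℝ} (hr0 : 0 < r) (hr : r ≤ 1 / 2) (s t : UnitAddCircle) :
    ENNReal.ofReal (r + min r ‖t - s‖) ≤ volume (hitSet r t ∪ hitSet r s) := by
  obtain ⟨x, hx, hxe⟩ : ∃ x ∈ Set.Ioc (-(1 / 2) : ℝ) (-(1 / 2) + 1),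
      (x : UnitAddCircle) = s - t := by
    have := AddCircle.coe_image_Ioc_eq (1 : ℝ) (-(1 / 2))
    have h2 : s - t ∈ ((↑) '' Set.Ioc (-(1 / 2) : ℝ) (-(1 / 2) + 1) : Set UnitAddCircle) := by
      rw [this]; trivial
    exact h2
  have hx2 : x ≤ 1 / 2 := by linarith [hx.2]
  have hn : ‖t - s‖ = |x| := by
    rw [← norm_neg, neg_sub, ← hxe]
    refine (AddCircle.norm_coe_eq_abs_iff (1 : ℝ) one_ne_zero).2 ?_
    rw [abs_one]
    exact abs_le.2 ⟨hx.1.le, hx2⟩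
  rw [hn]
  rcases le_total 0 x with h0 | h0
  · rw [abs_of_nonneg h0]
    exact le_volume_hitSet_union_of_coe hr0 hr h0 hx2 hxe.symm
  · rw [abs_of_nonpos h0, Set.union_comm]
    refine le_volume_hitSet_union_of_coe hr0 hr (by linarith) (by linarith [hx.1]) ?_
    rw [AddCircle.coe_neg, hxe, neg_sub]

/-! ### Moments of the factors of a single arc -/

theorem measurable_factor (r : ℝ) :
    Measurable fun p : UnitAddCircle × UnitAddCircle => factor r p.1 p.2 := by
  unfold factor
  refine (measurable_const.sub ?_).div_const _
  exact (measurable_const.indicator (isOpen_arc r).measurableSet).comp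
    (measurable_snd.sub measurable_fst)

theorem factor_eq_indicator (r : ℝ) (w t : UnitAddCircle) :
    factor r w t = (hitSet r t)ᶜ.indicator (fun _ => (1 - r)⁻¹) w := by
  unfold factor
  by_cases h : t - w ∈ arc r
  · have h' : w ∉ (hitSet r t)ᶜ := fun h2 => h2 h
    simp [h, h']
  · have h' : w ∈ (hitSet r t)ᶜ := h
    simp [h, h']

theorem factor_nonneg {r : ℝ} (hr1 : r < 1) (w t : UnitAddCircle) : 0 ≤ factor r w t := by
  rw [factor_eq_indicator]
  exact Set.indicator_nonneg (fun _ _ => inv_nonneg.2 (by linarith)) _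

theorem lintegral_factor {r : ℝ} (hr0 : 0 < r) (hr1 : r < 1) (t : UnitAddCircle) :
    ∫⁻ w, ENNReal.ofReal (factor r w t) = 1 := by
  have h : ∀ w, ENNReal.ofReal (factor r w t)
      = (hitSet r t)ᶜ.indicator (fun _ => ENNReal.ofReal (1 - r)⁻¹) w := by
    intro w
    rw [factor_eq_indicator]
    by_cases h : w ∈ (hitSet r t)ᶜ <;> simp [h]
  simp_rw [h]
  rw [lintegral_indicator_const (measurableSet_hitSet r t).compl,
    prob_compl_eq_one_sub (measurableSet_hitSet r t), volume_hitSet hr1.le,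
    ← ENNReal.ofReal_one, ← ENNReal.ofReal_sub _ hr0.le, ← ENNReal.ofReal_mul (by simp [hr1.le]),
    inv_mul_cancel₀ (by linarith)]

/-- The contribution of an arc of length `r` to the exponent of the kernel. -/
noncomputable def overlap (r : ℝ) (u : UnitAddCircle) : ℝ := max (r - ‖u‖) 0

theorem inv_one_sub_le_exp {r : ℝ} (hr0 : 0 ≤ r) (hr : r ≤ 1 / 2) :
    (1 - r)⁻¹ ≤ Real.exp (r + r ^ 2) := by
  rw [inv_le_iff_one_le_mul₀ (by linarith)]
  have h := Real.quadratic_le_exp_of_nonneg (x := r + r ^ 2) (by positivity)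
  have h2 : 1 ≤ (1 + (r + r ^ 2) + (r + r ^ 2) ^ 2 / 2) * (1 - r) := by
    -- Half of this expression is the difference of the two sides of `h2`.
    have : 0 ≤ r ^ 2 * ((1 - r ^ 2) * (1 + r) - 2 * r) := by
      refine mul_nonneg (sq_nonneg r) ?_
      nlinarith [sq_nonneg r, mul_nonneg hr0 (sq_nonneg r), mul_nonneg hr0 (sub_nonneg.2 hr), mul_nonneg (sq_nonneg r) (sub_nonneg.2 hr)]
    nlinarith
  exact h2.trans (mul_le_mul_of_nonneg_right h (by linarith))

section
variable {ι : Type*} [Fintype ι]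

theorem prod_factor_mul_factor_eq (r : ℝ) (w : UnitAddCircle) (t s : ι → UnitAddCircle) :
    ∏ i, (ENNReal.ofReal (factor r w (t i)) * ENNReal.ofReal (factor r w (s i)))
      = (⋃ i, (hitSet r (t i) ∪ hitSet r (s i)))ᶜ.indicator
          (fun _ => ENNReal.ofReal (1 - r)⁻¹ ^ (2 * Fintype.card ι)) w := by
  by_cases h : w ∈ ⋃ i, (hitSet r (t i) ∪ hitSet r (s i))
  · rw [Set.indicator_of_notMem (Set.notMem_compl_iff.2 h)]
    obtain ⟨i, hi⟩ := Set.mem_iUnion.1 h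
    refine Finset.prod_eq_zero (Finset.mem_univ i) ?_
    rcases hi with hi | hi <;> simp [factor_eq_indicator, hi]
  · rw [Set.indicator_of_mem (show w ∈ _ᶜ from h)]
    simp only [Set.mem_iUnion, Set.mem_union, not_exists, not_or] at h
    have : ∀ i, ENNReal.ofReal (factor r w (t i)) * ENNReal.ofReal (factor r w (s i))
        = ENNReal.ofReal (1 - r)⁻¹ ^ 2 := by
      intro i
      rw [sq]
      simp [factor_eq_indicator, (h i).1, (h i).2]
    rw [Finset.prod_congr rfl fun i _ => this i, Finset.prod_const, ← pow_mul, Finset.card_univ]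

theorem lintegral_prod_factor_le (r : ℝ) (t s : ι → UnitAddCircle) :
    ∫⁻ w, ∏ i, (ENNReal.ofReal (factor r w (t i)) * ENNReal.ofReal (factor r w (s i)))
      ≤ ENNReal.ofReal (1 - r)⁻¹ ^ (2 * Fintype.card ι) := by
  simp_rw [prod_factor_mul_factor_eq]
  refine (lintegral_indicator_const_le _ _).trans ?_
  exact mul_le_of_le_one_right' prob_le_one

/-- By disjointness the avoidance probability is 1 minus a sum over pairs, each pair costing at
least 2r minus its overlap. With 1 + x ≤ exp x, the linear terms cancel against the normalization
(1-r)⁻¹ ≤ exp(r + r²), leaving the overlaps and a quadratic error. -/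
theorem lintegral_prod_factor_le_of_disjoint {r : ℝ} (hr0 : 0 < r) (hr : r ≤ 1 / 2)
    (t s : ι → UnitAddCircle)
    (hd : Pairwise (Function.onFun Disjoint fun i => hitSet r (t i) ∪ hitSet r (s i))) :
    ∫⁻ w, ∏ i, (ENNReal.ofReal (factor r w (t i)) * ENNReal.ofReal (factor r w (s i)))
      ≤ ENNReal.ofReal (Real.exp (2 * Fintype.card ι * r ^ 2))
        * ∏ i, ENNReal.ofReal (Real.exp (overlap r (t i - s i))) := by
  have hm : ∀ i, MeasurableSet (hitSet r (t i) ∪ hitSet r (s i)) := fun i =>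
    (measurableSet_hitSet _ _).union (measurableSet_hitSet _ _)
  simp_rw [prod_factor_mul_factor_eq]
  rw [lintegral_indicator_const (MeasurableSet.iUnion hm).compl,
    prob_compl_eq_one_sub (MeasurableSet.iUnion hm), measure_iUnion hd hm, tsum_fintype]
  set n := Fintype.card ι with hn
  have hov : ∀ i, r + min r ‖t i - s i‖ = 2 * r - overlap r (t i - s i) := by
    intro i
    unfold overlap
    rcases le_total r ‖t i - s i‖ with h | h
    · rw [min_eq_left h, max_eq_right (by linarith)]; ring
    · rw [min_eq_right h, max_eq_left (by linarith)]; ring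
  have hsum : ENNReal.ofReal (∑ i, (2 * r - overlap r (t i - s i)))
      ≤ ∑ i, volume (hitSet r (t i) ∪ hitSet r (s i)) := by
    rw [ENNReal.ofReal_sum_of_nonneg]
    · refine Finset.sum_le_sum fun i _ => ?_
      rw [← hov]
      exact le_volume_hitSet_union hr0 hr _ _
    · intro i _
      rw [← hov]
      exact add_nonneg hr0.le (le_min hr0.le (norm_nonneg _))
  have hsum' : ∑ i, (2 * r - overlap r (t i - s i))
      = 2 * n * r - ∑ i, overlap r (t i - s i) := by
    rw [Finset.sum_sub_distrib, Finset.sum_const, Finset.card_univ, nsmul_eq_mul]; ring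
  have h1 : (1 : ℝ≥0∞) - ∑ i, volume (hitSet r (t i) ∪ hitSet r (s i))
      ≤ ENNReal.ofReal (Real.exp (-(2 * n * r) + ∑ i, overlap r (t i - s i))) := by
    refine (tsub_le_tsub_left hsum _).trans ?_
    rw [← ENNReal.ofReal_one, hsum']
    rw [tsub_le_iff_right]
    refine le_trans (ENNReal.ofReal_le_ofReal ?_) ENNReal.ofReal_add_le
    have := Real.add_one_le_exp (-(2 * n * r) + ∑ i, overlap r (t i - s i))
    linarith
  have h2 : ENNReal.ofReal (1 - r)⁻¹ ^ (2 * n)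
      ≤ ENNReal.ofReal (Real.exp (2 * n * (r + r ^ 2))) := by
    have : Real.exp (2 * n * (r + r ^ 2)) = Real.exp (r + r ^ 2) ^ (2 * n) := by
      rw [← Real.exp_nat_mul]; push_cast; rfl
    rw [this, ENNReal.ofReal_pow (Real.exp_pos _).le]
    exact pow_le_pow_left' (ENNReal.ofReal_le_ofReal (inv_one_sub_le_exp hr0.le hr)) _
  refine (mul_le_mul' h2 h1).trans (le_of_eq ?_)
  rw [← ENNReal.ofReal_prod_of_nonneg fun _ _ => (Real.exp_pos _).le, ← Real.exp_sum,
    ← ENNReal.ofReal_mul (Real.exp_pos _).le, ← ENNReal.ofReal_mul (Real.exp_pos _).le,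
    ← Real.exp_add, ← Real.exp_add]
  congr 2; ring

end

/-! ### The kernel, and square summability of the lengths -/

theorem prod_exp_overlap_le_kernel (ℓ : ℕ → ℝ) (n : ℕ) (u : UnitAddCircle) :
    ∏ k ∈ Finset.range n, ENNReal.ofReal (Real.exp (overlap (ℓ k) u)) ≤ kernel ℓ u := by
  rw [← ENNReal.ofReal_prod_of_nonneg fun _ _ => (Real.exp_pos _).le, ← Real.exp_sum,
    ← EReal.exp_coe, kernel, EReal.exp_le_exp_iff]
  have : ((∑ k ∈ Finset.range n, overlap (ℓ k) u : ℝ) : EReal)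
      = ((∑ k ∈ Finset.range n, ENNReal.ofReal (ℓ k - ‖u‖) : ℝ≥0∞) : EReal) := by
    have h : ∑ k ∈ Finset.range n, ENNReal.ofReal (ℓ k - ‖u‖)
        = ENNReal.ofReal (∑ k ∈ Finset.range n, overlap (ℓ k) u) := by
      rw [ENNReal.ofReal_sum_of_nonneg (f := fun k => overlap (ℓ k) u)
        fun _ _ => le_max_right _ _]
      refine Finset.sum_congr rfl fun k _ => ?_
      simp [overlap, ENNReal.ofReal_max]
    rw [h, EReal.coe_ennreal_ofReal, max_eq_left]
    exact Finset.sum_nonneg fun _ _ => le_max_right _ _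
  rw [this]
  exact EReal.coe_ennreal_le_coe_ennreal_iff.2 (ENNReal.sum_le_tsum _)

theorem one_le_kernel (ℓ : ℕ → ℝ) (u : UnitAddCircle) : 1 ≤ kernel ℓ u := by
  simpa using prod_exp_overlap_le_kernel ℓ 0 u

theorem measurable_kernel (ℓ : ℕ → ℝ) : Measurable (kernel ℓ) := by
  unfold kernel
  refine EReal.measurable_exp.comp (measurable_coe_ennreal_ereal.comp ?_)
  exact Measurable.tsum fun n => (measurable_const.sub measurable_norm).ennreal_ofReal

/-- With E_n = exp(ℓ_0 + ⋯ + ℓ_{n-1}) ≥ 1 one has ℓ_n ≤ E_{n+1} - E_n, hence ∑ ℓ_n² ≤ ∑ ℓ_n (E_{n+1}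
- E_n). Abel summation reduces this to the series in (B) plus a boundary term ℓ_N E_N. -/
theorem summable_sq_of_summable_sub_mul_exp {ℓ : ℕ → ℝ} (hℓ_pos : ∀ n, 0 < ℓ n)
    (hℓ_anti : Antitone ℓ) (hℓ_zero : Tendsto ℓ atTop (𝓝 0))
    (hB : Summable fun n =>
      (ℓ n - ℓ (n + 1)) * Real.exp (∑ k ∈ Finset.range (n + 1), ℓ k)) :
    Summable fun n => ℓ n ^ 2 := by
  set E : ℕ → ℝ := fun n => Real.exp (∑ k ∈ Finset.range n, ℓ k) with hE
  set a : ℕ → ℝ := fun n => (ℓ n - ℓ (n + 1)) * E (n + 1) with ha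
  have ha0 : ∀ n, 0 ≤ a n := fun n =>
    mul_nonneg (sub_nonneg.2 (hℓ_anti n.le_succ)) (Real.exp_pos _).le
  have hEmono : Monotone E := fun m n hmn => Real.exp_le_exp.2
    (Finset.sum_le_sum_of_subset_of_nonneg (Finset.range_mono hmn) fun k _ _ => (hℓ_pos k).le)
  have hEsucc : ∀ n, ℓ n ≤ E (n + 1) - E n := by
    intro n
    have h1 : 1 ≤ E n := Real.one_le_exp (Finset.sum_nonneg fun k _ => (hℓ_pos k).le)
    have h2 : E (n + 1) = E n * Real.exp (ℓ n) := by
      simp only [hE]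
      rw [Finset.sum_range_succ, Real.exp_add]
    have h3 := Real.add_one_le_exp (ℓ n)
    rw [h2]
    nlinarith [hℓ_pos n]
  have hpart : ∀ N M, N ≤ M → (ℓ N - ℓ M) * E N ≤ ∑ n ∈ Finset.range M, a n := by
    intro N M h
    induction M, h using Nat.le_induction with
    | base => simpa using Finset.sum_nonneg fun n _ => ha0 n
    | succ M h ih =>
      rw [Finset.sum_range_succ]
      have : (ℓ M - ℓ (M + 1)) * E N ≤ a M :=
        mul_le_mul_of_nonneg_left (hEmono (h.trans M.le_succ))
          (sub_nonneg.2 (hℓ_anti M.le_succ))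
      linarith
  -- The boundary term is ℓ_N E_N = ∑_{n≥N} (ℓ_n - ℓ_{n+1}) E_N, again dominated by the series in
  -- (B); hence the factor 2 in the final bound.
  have hlim : ∀ N, ℓ N * E N ≤ ∑' n, a n := by
    intro N
    have h1 : Tendsto (fun M => (ℓ N - ℓ M) * E N) atTop (𝓝 ((ℓ N - 0) * E N)) :=
      (tendsto_const_nhds.sub hℓ_zero).mul_const _
    rw [sub_zero] at h1
    refine le_of_tendsto h1 (eventually_atTop.2 ⟨N, fun M hM => (hpart N M hM).trans ?_⟩)
    exact hB.sum_le_tsum _ fun n _ => ha0 n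
  have habel : ∀ N, ∑ n ∈ Finset.range N, ℓ n * (E (n + 1) - E n)
      = ∑ n ∈ Finset.range N, a n + ℓ N * E N - ℓ 0 * E 0 := by
    intro N
    induction N with
    | zero => simp
    | succ N ih =>
      rw [Finset.sum_range_succ, Finset.sum_range_succ, ih]
      simp only [ha]
      ring
  refine summable_of_sum_range_le (c := 2 * ∑' n, a n) (fun n => sq_nonneg _) fun N => ?_
  have h1 : ∑ n ∈ Finset.range N, ℓ n ^ 2 ≤ ∑ n ∈ Finset.range N, ℓ n * (E (n + 1) - E n) :=
    Finset.sum_le_sum fun n _ => by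
      rw [sq]; exact mul_le_mul_of_nonneg_left (hEsucc n) (hℓ_pos n).le
  have h2 : ∑ n ∈ Finset.range N, a n ≤ ∑' n, a n := hB.sum_le_tsum _ fun n _ => ha0 n
  have h3 : 0 ≤ ℓ 0 * E 0 := mul_nonneg (hℓ_pos 0).le (Real.exp_pos _).le
  linarith [habel N, hlim N]

theorem ofReal_density {ℓ : ℕ → ℝ} (hℓ_lt : ∀ n, ℓ n < 1) (w : ℕ → UnitAddCircle) (n : ℕ)
    (t : UnitAddCircle) :
    ENNReal.ofReal (density ℓ w n t) = ∏ k ∈ Finset.range n, ENNReal.ofReal (factor (ℓ k) (w k) t) :=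
  ENNReal.ofReal_prod_of_nonneg fun k _ => factor_nonneg (hℓ_lt k) _ _

theorem measurable_density (ℓ : ℕ → ℝ) (n : ℕ) :
    Measurable fun p : (ℕ → UnitAddCircle) × UnitAddCircle => density ℓ p.1 n p.2 := by
  unfold density
  refine Finset.measurable_fun_prod _ fun k _ => ?_
  exact (measurable_factor (ℓ k)).comp (by fun_prop : Measurable
    fun p : (ℕ → UnitAddCircle) × UnitAddCircle => (p.1 k, p.2))

/-! ### Independence and the uniform second moment bound -/

section
variable {Ω : Type*} [MeasurableSpace Ω] {P : Measure Ω}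
  {ω : ℕ → Ω → UnitAddCircle} {ℓ : ℕ → ℝ}

theorem lintegral_prod_comp_eq (hω_meas : ∀ n, Measurable (ω n)) (hω_indep : iIndepFun ω P)
    (hω_unif : ∀ n, P.map (ω n) = volume) {G : ℕ → UnitAddCircle → ℝ≥0∞}
    (hG : ∀ k, Measurable (G k)) (n : ℕ) :
    ∫⁻ x, ∏ k ∈ Finset.range n, G k (ω k x) ∂P = ∏ k ∈ Finset.range n, ∫⁻ w, G k w := by
  have h := lintegral_prod_eq_prod_lintegral_of_indepFun (Finset.range n)
    (fun k => G k ∘ ω k) (hω_indep.comp G hG) fun k => (hG k).comp (hω_meas k)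
  refine h.trans (Finset.prod_congr rfl fun k _ => ?_)
  rw [← hω_unif k, lintegral_map (hG k) (hω_meas k)]
  rfl

theorem lintegral_density_eq_one (hω_meas : ∀ n, Measurable (ω n)) (hω_indep : iIndepFun ω P)
    (hω_unif : ∀ n, P.map (ω n) = volume) (hℓ_pos : ∀ n, 0 < ℓ n) (hℓ_lt : ∀ n, ℓ n < 1)
    (n : ℕ) (t : UnitAddCircle) :
    ∫⁻ x, ENNReal.ofReal (density ℓ (fun k => ω k x) n t) ∂P = 1 := by
  simp_rw [ofReal_density hℓ_lt]
  rw [lintegral_prod_comp_eq hω_meas hω_indep hω_unif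
    (G := fun k w => ENNReal.ofReal (factor (ℓ k) w t))
    fun k => ((measurable_factor (ℓ k)).comp measurable_prodMk_right).ennreal_ofReal]
  exact Finset.prod_eq_one fun k _ => lintegral_factor (hℓ_pos k) (hℓ_lt k) t

/-- Independence reduces the expectation to a product over arcs. Short arcs satisfy the disjoint
estimate with summable errors; the finitely many long ones only affect the constant. The index type
is `Fin (d + 1)` for the main estimate and `Unit` for the absence of atoms. -/
theorem exists_lintegral_prod_density_le (hω_meas : ∀ n, Measurable (ω n))
    (hω_indep : iIndepFun ω P) (hω_unif : ∀ n, P.map (ω n) = volume)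
    (hℓ_pos : ∀ n, 0 < ℓ n) (hℓ_lt : ∀ n, ℓ n < 1) (hℓ_zero : Tendsto ℓ atTop (𝓝 0))
    (hsq : Summable fun n => ℓ n ^ 2) {ι : Type*} [Fintype ι] {ε : ℝ} (hε : 0 < ε)
    {c : ι → UnitAddCircle} (hc : Pairwise fun i j => 4 * ε ≤ dist (c i) (c j)) :
    ∃ C : ℝ≥0, ∀ (n : ℕ) (t s : ι → UnitAddCircle), (∀ i, t i ∈ Metric.ball (c i) ε) →
      (∀ i, s i ∈ Metric.ball (c i) ε) →
      ∫⁻ x, ∏ i, (ENNReal.ofReal (density ℓ (fun k => ω k x) n (t i))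
        * ENNReal.ofReal (density ℓ (fun k => ω k x) n (s i))) ∂P
      ≤ C * ∏ i, kernel ℓ (t i - s i) := by
  classical
  set m : ℝ := (Fintype.card ι : ℝ) with hm
  -- `a k` is the logarithm of the loss at arc `k`: the quadratic error for a short arc, the crude
  -- bound (1 - ℓ_k)^(-2m) for a long one.
  set a : ℕ → ℝ := fun k => if ℓ k ≤ min ε (1 / 2) then 2 * m * ℓ k ^ 2
    else 2 * m * Real.log (1 - ℓ k)⁻¹ with ha
  have ha0 : ∀ k, 0 ≤ a k := by
    intro k
    simp only [ha]
    split_ifs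
    · positivity
    · have : 0 ≤ Real.log (1 - ℓ k)⁻¹ :=
        Real.log_nonneg ((one_le_inv₀ (by linarith [hℓ_lt k])).2 (by linarith [hℓ_pos k]))
      positivity
  have hasum : Summable a := by
    refine (summable_congr_cofinite ?_).1 (hsq.mul_left (2 * m))
    rw [Nat.cofinite_eq_atTop]
    filter_upwards [hℓ_zero.eventually_le_const (show (0 : ℝ) < min ε (1 / 2) by positivity)]
      with k hk
    simp only [ha]
    rw [if_pos hk]
  refine ⟨(Real.exp (∑' k, a k)).toNNReal, fun n t s ht hs => ?_⟩
  have hswap : ∀ x, ∏ i, (ENNReal.ofReal (density ℓ (fun k => ω k x) n (t i))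
        * ENNReal.ofReal (density ℓ (fun k => ω k x) n (s i)))
      = ∏ k ∈ Finset.range n, ∏ i, (ENNReal.ofReal (factor (ℓ k) (ω k x) (t i))
        * ENNReal.ofReal (factor (ℓ k) (ω k x) (s i))) := by
    intro x
    simp_rw [ofReal_density hℓ_lt, ← Finset.prod_mul_distrib]
    exact Finset.prod_comm
  simp_rw [hswap]
  rw [lintegral_prod_comp_eq hω_meas hω_indep hω_unif
    (G := fun k w => ∏ i, (ENNReal.ofReal (factor (ℓ k) w (t i))
        * ENNReal.ofReal (factor (ℓ k) w (s i))))
    fun k => Finset.measurable_fun_prod _ fun i _ =>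
      ((measurable_factor (ℓ k)).comp measurable_prodMk_right).ennreal_ofReal.mul
      ((measurable_factor (ℓ k)).comp measurable_prodMk_right).ennreal_ofReal]
  have hk : ∀ k, ∫⁻ w, ∏ i, (ENNReal.ofReal (factor (ℓ k) w (t i))
        * ENNReal.ofReal (factor (ℓ k) w (s i)))
      ≤ ENNReal.ofReal (Real.exp (a k))
        * ∏ i, ENNReal.ofReal (Real.exp (overlap (ℓ k) (t i - s i))) := by
    intro k
    by_cases h : ℓ k ≤ min ε (1 / 2)
    · simp only [ha]
      rw [if_pos h]
      refine lintegral_prod_factor_le_of_disjoint (hℓ_pos k) (h.trans (min_le_right _ _)) t s ?_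
      -- An arc of length at most ε covering a point of the ε-ball around `c i` starts within 2ε of
      -- `c i`; centers 4ε apart make these regions disjoint.
      have hsub : ∀ i, hitSet (ℓ k) (t i) ∪ hitSet (ℓ k) (s i) ⊆ Metric.ball (c i) (2 * ε) := by
        intro i
        have hb : ∀ u ∈ Metric.ball (c i) ε, hitSet (ℓ k) u ⊆ Metric.ball (c i) (2 * ε) := by
          intro u hu
          refine (hitSet_subset_ball _ _).trans (Metric.ball_subset_ball' ?_)
          have := Metric.mem_ball.1 hu
          linarith [h.trans (min_le_left _ _)]
        exact Set.union_subset (hb _ (ht i)) (hb _ (hs i))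
      intro i j hij
      refine (Metric.ball_disjoint_ball ?_).mono (hsub i) (hsub j)
      linarith [hc hij]
    · simp only [ha]
      rw [if_neg h]
      refine (lintegral_prod_factor_le _ t s).trans ?_
      refine le_mul_of_le_of_one_le (le_of_eq ?_) ?_
      · have hpos : 0 < (1 - ℓ k)⁻¹ := inv_pos.2 (by linarith [hℓ_lt k])
        rw [← ENNReal.ofReal_pow hpos.le]
        have : Real.exp (2 * m * Real.log (1 - ℓ k)⁻¹)
            = Real.exp (Real.log (1 - ℓ k)⁻¹) ^ (2 * Fintype.card ι) := by
          rw [← Real.exp_nat_mul, hm]; push_cast; rfl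
        rw [this, Real.exp_log hpos]
      · refine Finset.one_le_prod' fun i _ => ?_
        rw [← ENNReal.ofReal_one]
        exact ENNReal.ofReal_le_ofReal (Real.one_le_exp (le_max_right _ _))
  refine (Finset.prod_le_prod' fun k _ => hk k).trans ?_
  rw [Finset.prod_mul_distrib, Finset.prod_comm]
  refine mul_le_mul' ?_ (Finset.prod_le_prod' fun i _ => prod_exp_overlap_le_kernel ℓ n _)
  rw [← ENNReal.ofReal_prod_of_nonneg fun _ _ => (Real.exp_pos _).le, ← Real.exp_sum]
  exact ENNReal.ofReal_le_ofReal (Real.exp_le_exp.2 (hasum.sum_le_tsum _ fun k _ => ha0 k))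

end

/-! ### Weak convergence and finite products of finite measures -/

theorem integral_one_eq_mass {X : Type*} [MeasurableSpace X] (μ : FiniteMeasure X) : ∫ _, (1 : ℝ) ∂(μ : Measure X) = μ.mass := by
  rw [integral_const, smul_eq_mul, mul_one]
  rfl

theorem pi_eq_smul_normalize {ι : Type*} [Fintype ι] {X : Type*} [MeasurableSpace X]
    [Nonempty X] (μ : FiniteMeasure X) :
    FiniteMeasure.pi (fun _ : ι => μ) = μ.mass ^ Fintype.card ι •
      (ProbabilityMeasure.pi (fun _ : ι => μ.normalize)).toFiniteMeasure := by
  apply Subtype.ext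
  refine Measure.pi_eq (μ := fun _ : ι => (μ : Measure X)) fun s hs => ?_
  have h : ∀ i, (μ : Measure X) (s i) = μ.mass * (μ.normalize : Measure X) (s i) := fun i => by
    rw [← FiniteMeasure.ennreal_coeFn_eq_coeFn_toMeasure, μ.self_eq_mass_mul_normalize,
      ENNReal.coe_mul, ProbabilityMeasure.ennreal_coeFn_eq_coeFn_toMeasure]
  have h2 : ((μ.mass ^ Fintype.card ι •
      (ProbabilityMeasure.pi (fun _ : ι => μ.normalize)).toFiniteMeasure : FiniteMeasure (ι → X))
      : Measure (ι → X)) (Set.univ.pi s) = (μ.mass : ℝ≥0∞) ^ Fintype.card ι *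
        Measure.pi (fun _ : ι => (μ.normalize : Measure X)) (Set.univ.pi s) := by
    rw [FiniteMeasure.toMeasure_smul, Measure.smul_apply, ← ENNReal.coe_pow]
    rfl
  refine h2.trans ?_
  rw [Measure.pi_pi, Finset.prod_congr rfl fun i _ => h i, Finset.prod_mul_distrib,
    Finset.prod_const, Finset.card_univ]

section WeakConvergence
variable {X : Type*} [TopologicalSpace X] [MeasurableSpace X] [BorelSpace X]

theorem continuous_integral_of_finiteMeasure [CompactSpace X] (μ : Measure X) [IsFiniteMeasure μ] :
    Continuous fun f : C(X, ℝ) => ∫ x, f x ∂μ := by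
  refine LipschitzWith.continuous (K := (μ Set.univ).toNNReal)
    (LipschitzWith.of_dist_le_mul fun f g => ?_)
  have hi : ∀ f : C(X, ℝ), Integrable f μ := fun f =>
    f.continuous.integrable_of_hasCompactSupport (HasCompactSupport.of_compactSpace f)
  rw [dist_eq_norm, ← integral_sub (hi f) (hi g)]
  refine (norm_integral_le_of_norm_le_const (C := dist f g)
    (Eventually.of_forall fun x => ?_)).trans (le_of_eq (mul_comm _ _))
  rw [← dist_eq_norm]
  exact ContinuousMap.dist_apply_le_dist x

/-- Bounded masses keep the sequence in a compact set. Two cluster points have equal integrals on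
`S`, hence on all continuous functions by density, so the cluster point is unique and is the limit.
-/
theorem exists_tendsto_finiteMeasure [CompactSpace X] [T2Space X] [HasOuterApproxClosed X]
    {ν : ℕ → FiniteMeasure X} {S : Set C(X, ℝ)} (hS : Dense S)
    (h1 : ∃ c, Tendsto (fun n => ∫ _, (1 : ℝ) ∂(ν n : Measure X)) atTop (𝓝 c))
    (h : ∀ f ∈ S, ∃ c, Tendsto (fun n => ∫ x, f x ∂(ν n : Measure X)) atTop (𝓝 c)) :
    ∃ μ, Tendsto ν atTop (𝓝 μ) := by
  obtain ⟨c, hc⟩ := h1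
  simp_rw [integral_one_eq_mass] at hc
  obtain ⟨B, hB⟩ := hc.bddAbove_range
  have hK := isCompact_setOfPred_finiteMeasure_le_of_compactSpace X B.toNNReal
  have hmem : ∀ n, ν n ∈ {μ : FiniteMeasure X | μ.mass ≤ B.toNNReal} := fun n =>
    NNReal.le_toNNReal_of_coe_le (hB ⟨n, rfl⟩)
  obtain ⟨μ, -, hμ⟩ := hK.exists_mapClusterPt (f := atTop) (u := ν)
    (le_principal_iff.2 (mem_map.2 (Eventually.of_forall hmem)))
  have hlim : ∀ ρ, MapClusterPt ρ atTop ν → ∀ f ∈ S, ∀ c,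
      Tendsto (fun n => ∫ x, f x ∂(ν n : Measure X)) atTop (𝓝 c) →
      ∫ x, f x ∂(ρ : Measure X) = c := by
    intro ρ hρ f _ c hc
    have hcont : Continuous fun μ : FiniteMeasure X => ∫ x, f x ∂(μ : Measure X) :=
      FiniteMeasure.continuous_integral_continuousMap f
    have h2 : MapClusterPt (∫ x, f x ∂(ρ : Measure X)) atTop
        (fun n => ∫ x, f x ∂(ν n : Measure X)) :=
      hρ.continuousAt_comp hcont.continuousAt
    exact eq_of_nhds_neBot (ClusterPt.mono h2 hc)
  refine ⟨μ, hK.tendsto_nhds_of_unique_mapClusterPt (Eventually.of_forall hmem)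
    fun ρ _ hρ => ?_⟩
  refine FiniteMeasure.ext_of_forall_integral_eq fun f => ?_
  have hclosed := isClosed_eq (continuous_integral_of_finiteMeasure (ρ : Measure X))
    (continuous_integral_of_finiteMeasure (μ : Measure X))
  refine closure_minimal (s := S) (fun f hf => ?_) hclosed (hS f.toContinuousMap)
  obtain ⟨c, hc⟩ := h f hf
  exact (hlim ρ hρ f hf c hc).trans (hlim μ hμ f hf c hc).symm

/-- Normalizing reduces to products of probability measures. Normalization is not continuous at the
zero measure, so a zero limit is treated separately, through the masses. -/
theorem tendsto_finiteMeasure_pi {ι : Type*} [Fintype ι] [Nonempty ι] [Nonempty X]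
    [SecondCountableTopology X] [TopologicalSpace.PseudoMetrizableSpace X]
    {ν : ℕ → FiniteMeasure X} {μ : FiniteMeasure X} (h : Tendsto ν atTop (𝓝 μ)) :
    Tendsto (fun n => FiniteMeasure.pi (fun _ : ι => ν n)) atTop
      (𝓝 (FiniteMeasure.pi (fun _ : ι => μ))) := by
  have hmass : Tendsto (fun n => (ν n).mass ^ Fintype.card ι) atTop
      (𝓝 (μ.mass ^ Fintype.card ι)) := h.mass.pow _
  by_cases h0 : μ = 0
  · have hz : FiniteMeasure.pi (fun _ : ι => μ) = 0 := by
      rw [← FiniteMeasure.mass_zero_iff, FiniteMeasure.mass_pi, h0]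
      simp
    rw [hz]
    refine FiniteMeasure.tendsto_zero_of_tendsto_zero_mass ?_
    simp_rw [FiniteMeasure.mass_pi, Finset.prod_const, Finset.card_univ]
    rw [h0] at hmass
    simpa using hmass
  · simp_rw [pi_eq_smul_normalize]
    refine hmass.smul ?_
    have h1 := FiniteMeasure.tendsto_normalize_of_tendsto h h0
    have h2 := ((ProbabilityMeasure.continuous_pi (α := fun _ : ι => X)).tendsto
      (fun _ => μ.normalize)).comp (tendsto_pi_nhds.2 fun _ => h1)
    exact (ProbabilityMeasure.tendsto_nhds_iff_toFiniteMeasure_tendsto_nhds _).1 h2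

theorem tendsto_lintegral_pi {ι : Type*} [Fintype ι] [Nonempty ι] [Nonempty X] [CompactSpace X]
    [SecondCountableTopology X] [TopologicalSpace.PseudoMetrizableSpace X]
    {ν : ℕ → FiniteMeasure X} {μ : FiniteMeasure X} (h : Tendsto ν atTop (𝓝 μ))
    {F : (ι → X) → ℝ≥0} (hF : Continuous F) :
    Tendsto (fun n => ∫⁻ t, F t ∂Measure.pi (fun _ : ι => (ν n : Measure X))) atTop
      (𝓝 (∫⁻ t, F t ∂Measure.pi (fun _ : ι => (μ : Measure X)))) :=
  FiniteMeasure.tendsto_iff_forall_lintegral_tendsto.1 (tendsto_finiteMeasure_pi (ι := ι) h)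
    (BoundedContinuousFunction.mkOfCompact ⟨F, hF⟩)

end WeakConvergence

theorem lintegral_pi_prod {ι : Type*} [Fintype ι] {X : Type*} [MeasurableSpace X]
    (μ : Measure X) [IsProbabilityMeasure μ] {f : ι → X → ℝ≥0∞} (hf : ∀ i, Measurable (f i)) :
    ∫⁻ t, ∏ i, f i (t i) ∂Measure.pi (fun _ : ι => μ) = ∏ i, ∫⁻ x, f i x ∂μ := by
  have h := lintegral_prod_eq_prod_lintegral_of_indepFun (μ := Measure.pi fun _ : ι => μ)
    Finset.univ (fun i t => f i (t i))
    (iIndepFun_pi (X := f) fun i => (hf i).aemeasurable)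
    fun i => (hf i).comp (measurable_pi_apply i)
  refine h.trans (Finset.prod_congr rfl fun i _ => ?_)
  exact (measurePreserving_eval (fun _ : ι => μ) i).lintegral_comp (hf i)

theorem pi_withDensity {ι : Type*} [Fintype ι] {X : Type*} [MeasurableSpace X]
    (μ : Measure X) [IsProbabilityMeasure μ] {f : X → ℝ≥0∞} (hf : Measurable f)
    [SigmaFinite (μ.withDensity f)] :
    Measure.pi (fun _ : ι => μ.withDensity f)
      = (Measure.pi fun _ : ι => μ).withDensity fun t => ∏ i, f (t i) := by
  refine Measure.pi_eq fun s hs => ?_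
  rw [withDensity_apply _ (MeasurableSet.univ_pi hs), ← lintegral_indicator (MeasurableSet.univ_pi hs)]
  have h : ∀ t : ι → X, (Set.univ.pi s).indicator (fun t => ∏ i, f (t i)) t
      = ∏ i, (s i).indicator f (t i) := by
    intro t
    by_cases ht : t ∈ Set.univ.pi s
    · rw [Set.indicator_of_mem ht]
      exact Finset.prod_congr rfl fun i _ => (Set.indicator_of_mem (ht i trivial) _).symm
    · rw [Set.indicator_of_notMem ht]
      simp only [Set.mem_pi, Set.mem_univ, true_implies, not_forall] at ht
      obtain ⟨i, hi⟩ := ht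
      exact (Finset.prod_eq_zero (Finset.mem_univ i) (Set.indicator_of_notMem hi _)).symm
  simp_rw [h]
  rw [lintegral_pi_prod μ fun i => hf.indicator (hs i)]
  refine Finset.prod_congr rfl fun i _ => ?_
  rw [withDensity_apply _ (hs i), lintegral_indicator (hs i)]

theorem lintegral_pi_partialMeasure {ι : Type*} [Fintype ι] (ℓ : ℕ → ℝ) (w : ℕ → UnitAddCircle)
    (n : ℕ) {G : (ι → UnitAddCircle) → ℝ≥0∞} (hG : Measurable G) :
    ∫⁻ t, G t ∂Measure.pi (fun _ : ι => (partialMeasure ℓ w n : Measure UnitAddCircle))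
      = ∫⁻ t : ι → UnitAddCircle, G t * ∏ i, ENNReal.ofReal (density ℓ w n (t i)) := by
  have hm : Measurable fun t => ENNReal.ofReal (density ℓ w n t) :=
    ((measurable_density ℓ n).comp measurable_prodMk_left).ennreal_ofReal
  have : IsFiniteMeasure ((volume : Measure UnitAddCircle).withDensity
      fun t => ENNReal.ofReal (density ℓ w n t)) :=
    isFiniteMeasure_withDensity_ofReal (hasFiniteIntegral_density ℓ w n)
  have h := pi_withDensity (ι := ι) (volume : Measure UnitAddCircle) hm
  change ∫⁻ t, G t ∂Measure.pi (fun _ : ι => (volume : Measure UnitAddCircle).withDensity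
      fun t => ENNReal.ofReal (density ℓ w n t)) = _
  have hm' : Measurable fun t : ι → UnitAddCircle => ∏ i, ENNReal.ofReal (density ℓ w n (t i)) :=
    Finset.measurable_fun_prod _ fun i _ => hm.comp (measurable_pi_apply i)
  rw [h, lintegral_withDensity_eq_lintegral_mul _ hm' hG]
  exact lintegral_congr fun t => mul_comm _ _

/-! ### The martingales of integrals and almost sure weak convergence -/

theorem abs_density_le (ℓ : ℕ → ℝ) (w : ℕ → UnitAddCircle) (n : ℕ) (t : UnitAddCircle) :
    |density ℓ w n t| ≤ ∏ k ∈ Finset.range n, |1 - ℓ k|⁻¹ := by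
  rw [density, Finset.abs_prod]
  exact Finset.prod_le_prod (fun _ _ => abs_nonneg _) fun k _ => abs_factor_le _ _ _

theorem density_nonneg {ℓ : ℕ → ℝ} (hℓ_lt : ∀ n, ℓ n < 1) (w : ℕ → UnitAddCircle) (n : ℕ)
    (t : UnitAddCircle) : 0 ≤ density ℓ w n t :=
  Finset.prod_nonneg fun k _ => factor_nonneg (hℓ_lt k) _ _

theorem density_congr (ℓ : ℕ → ℝ) {w w' : ℕ → UnitAddCircle} {n : ℕ}
    (h : ∀ k < n, w k = w' k) (t : UnitAddCircle) : density ℓ w n t = density ℓ w' n t :=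
  Finset.prod_congr rfl fun k hk => by rw [h k (Finset.mem_range.1 hk)]

/-- The integral of a continuous function against `partialMeasure ℓ w n`. -/
noncomputable def pairing (ℓ : ℕ → ℝ) (f : C(UnitAddCircle, ℝ)) (n : ℕ)
    (w : ℕ → UnitAddCircle) : ℝ :=
  ∫ t, f t * density ℓ w n t

theorem integral_partialMeasure {ℓ : ℕ → ℝ} (hℓ_lt : ∀ n, ℓ n < 1) (w : ℕ → UnitAddCircle)
    (n : ℕ) (f : C(UnitAddCircle, ℝ)) :
    ∫ t, f t ∂(partialMeasure ℓ w n : Measure UnitAddCircle) = pairing ℓ f n w := by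
  have hm : Measurable fun t => ENNReal.ofReal (density ℓ w n t) :=
    ((measurable_density ℓ n).comp measurable_prodMk_left).ennreal_ofReal
  change ∫ t, f t ∂(volume.withDensity fun t => ENNReal.ofReal (density ℓ w n t)) = _
  rw [integral_withDensity_eq_integral_toReal_smul hm (by simp)]
  refine integral_congr_ae (Eventually.of_forall fun t => ?_)
  simp only [smul_eq_mul, ENNReal.toReal_ofReal (density_nonneg hℓ_lt w n t)]
  exact mul_comm _ _

theorem measurable_pairing (ℓ : ℕ → ℝ) (f : C(UnitAddCircle, ℝ)) (n : ℕ) :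
    Measurable (pairing ℓ f n) := by
  have h : Measurable fun p : (ℕ → UnitAddCircle) × UnitAddCircle =>
      f p.2 * density ℓ p.1 n p.2 :=
    (f.continuous.measurable.comp measurable_snd).mul (measurable_density ℓ n)
  exact (h.stronglyMeasurable.integral_prod_right (ν := volume)).measurable

theorem pairing_congr (ℓ : ℕ → ℝ) (f : C(UnitAddCircle, ℝ)) {w w' : ℕ → UnitAddCircle} {n : ℕ}
    (h : ∀ k < n, w k = w' k) : pairing ℓ f n w = pairing ℓ f n w' := by
  simp only [pairing, density_congr ℓ h]

theorem abs_mul_density_le (ℓ : ℕ → ℝ) (f : C(UnitAddCircle, ℝ)) (n : ℕ)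
    (w : ℕ → UnitAddCircle) (t : UnitAddCircle) :
    |f t * density ℓ w n t| ≤ ‖f‖ * ∏ k ∈ Finset.range n, |1 - ℓ k|⁻¹ := by
  rw [abs_mul]
  exact mul_le_mul (f.norm_coe_le_norm t) (abs_density_le ℓ w n t) (abs_nonneg _) (norm_nonneg _)

theorem abs_pairing_le (ℓ : ℕ → ℝ) (f : C(UnitAddCircle, ℝ)) (n : ℕ) (w : ℕ → UnitAddCircle) :
    |pairing ℓ f n w| ≤ ‖f‖ * ∏ k ∈ Finset.range n, |1 - ℓ k|⁻¹ := by
  have h := norm_integral_le_of_norm_le_const (μ := (volume : Measure UnitAddCircle))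
    (f := fun t => f t * density ℓ w n t) (Eventually.of_forall fun t => abs_mul_density_le ℓ f n w t)
  simpa [pairing] using h

section
variable {Ω : Type*} [MeasurableSpace Ω] {P : Measure Ω}
  {ω : ℕ → Ω → UnitAddCircle} {ℓ : ℕ → ℝ}

theorem measurable_path (hω_meas : ∀ n, Measurable (ω n)) :
    Measurable fun x => fun k => ω k x :=
  measurable_pi_lambda _ hω_meas

theorem measurable_path_density (hω_meas : ∀ n, Measurable (ω n)) (n : ℕ) :
    Measurable fun p : Ω × UnitAddCircle => density ℓ (fun k => ω k p.1) n p.2 := by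
  have h : Measurable fun p : Ω × UnitAddCircle => ((fun k => ω k p.1 : ℕ → UnitAddCircle), p.2) :=
    Measurable.prodMk (measurable_pi_lambda _ fun k => (hω_meas k).comp measurable_fst)
      measurable_snd
  have h2 := (measurable_density ℓ n).comp h
  exact h2

/-- The filtration generated by the left endpoints. -/
noncomputable def endpointFiltration (hω_meas : ∀ n, Measurable (ω n)) :
    Filtration ℕ (inferInstance : MeasurableSpace Ω) :=
  Filtration.natural ω fun n => (hω_meas n).stronglyMeasurable

theorem measurable_endpoint_of_le (hω_meas : ∀ n, Measurable (ω n)) {k n : ℕ} (hkn : k ≤ n) :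
    Measurable[endpointFiltration hω_meas n] (ω k) :=
  (((Filtration.stronglyAdapted_natural fun n => (hω_meas n).stronglyMeasurable) k).mono
    ((endpointFiltration hω_meas).mono hkn)).measurable

theorem measurable_truncated_path (hω_meas : ∀ n, Measurable (ω n)) (n : ℕ) :
    Measurable[endpointFiltration hω_meas n] fun x => fun k => if k ≤ n then ω k x else 0 := by
  refine @measurable_pi_lambda _ _ _ (endpointFiltration hω_meas n) _ _ fun k => ?_
  by_cases h : k ≤ n
  · simpa only [if_pos h] using measurable_endpoint_of_le hω_meas h
  · simp only [if_neg h]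
    exact @measurable_const _ _ _ (endpointFiltration hω_meas n) _

/-- The σ-algebra of index `n` contains the endpoints 0, …, n, which are those entering a product of
`n + 1` factors; hence the shift by one in the martingale. -/
theorem measurable_density_succ (hω_meas : ∀ n, Measurable (ω n)) (n : ℕ) (t : UnitAddCircle) :
    Measurable[endpointFiltration hω_meas n] fun x => density ℓ (fun k => ω k x) (n + 1) t := by
  have h : (fun x => density ℓ (fun k => ω k x) (n + 1) t)
      = (fun w => density ℓ w (n + 1) t) ∘ fun x => fun k => if k ≤ n then ω k x else 0 := by
    funext x
    exact density_congr ℓ (fun k hk => (if_pos (Nat.lt_succ_iff.1 hk)).symm) t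
  rw [h]
  exact ((measurable_density ℓ (n + 1)).comp measurable_prodMk_right).comp
    (measurable_truncated_path hω_meas n)

theorem measurable_pairing_succ (hω_meas : ∀ n, Measurable (ω n)) (f : C(UnitAddCircle, ℝ))
    (n : ℕ) :
    Measurable[endpointFiltration hω_meas n] fun x => pairing ℓ f (n + 1) fun k => ω k x := by
  have h : (fun x => pairing ℓ f (n + 1) fun k => ω k x)
      = pairing ℓ f (n + 1) ∘ fun x => fun k => if k ≤ n then ω k x else 0 := by
    funext x
    exact pairing_congr ℓ f fun k hk => (if_pos (Nat.lt_succ_iff.1 hk)).symm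
  rw [h]
  exact (measurable_pairing ℓ f (n + 1)).comp (measurable_truncated_path hω_meas n)

theorem integral_factor {r : ℝ} (hr0 : 0 < r) (hr1 : r < 1) (t : UnitAddCircle) :
    ∫ w, factor r w t = 1 := by
  rw [integral_eq_lintegral_of_nonneg_ae (Eventually.of_forall fun w => factor_nonneg hr1 w t)
    ((measurable_factor r).comp measurable_prodMk_right).aestronglyMeasurable,
    lintegral_factor hr0 hr1, ENNReal.toReal_one]

/-- The martingale identity at a fixed point t: the new factor is independent of the past and has
mean 1. Fubini (`setIntegral_pairing`) then carries it over to integrals against `f`. -/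
theorem setIntegral_density_succ (hω_meas : ∀ n, Measurable (ω n)) (hω_indep : iIndepFun ω P)
    (hω_unif : ∀ n, P.map (ω n) = volume) (hℓ_pos : ∀ n, 0 < ℓ n) (hℓ_lt : ∀ n, ℓ n < 1)
    (n : ℕ) (t : UnitAddCircle) {A : Set Ω}
    (hA : MeasurableSet[endpointFiltration hω_meas n] A) :
    ∫ x in A, density ℓ (fun k => ω k x) (n + 1 + 1) t ∂P
      = ∫ x in A, density ℓ (fun k => ω k x) (n + 1) t ∂P := by
  have hle := (endpointFiltration hω_meas).le n
  have hU : Measurable[endpointFiltration hω_meas n]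
      (A.indicator fun x => density ℓ (fun k => ω k x) (n + 1) t) :=
    (measurable_density_succ hω_meas n t).indicator hA
  have hVm : Measurable fun w => factor (ℓ (n + 1)) w t :=
    (measurable_factor _).comp measurable_prodMk_right
  have hind : IndepFun (A.indicator fun x => density ℓ (fun k => ω k x) (n + 1) t)
      (fun x => factor (ℓ (n + 1)) (ω (n + 1) x) t) P := by
    rw [IndepFun_iff_Indep]
    have h := hω_indep.indep_comap_natural_of_lt (fun n => (hω_meas n).stronglyMeasurable)
      n.lt_succ_self
    refine indep_of_indep_of_le_left (indep_of_indep_of_le_right h.symm ?_) hU.comap_le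
    rintro _ ⟨S, hS, rfl⟩
    exact ⟨_, hVm hS, rfl⟩
  have h1 := hind.integral_fun_mul_eq_mul_integral
    (hU.mono hle le_rfl).aestronglyMeasurable
    (hVm.comp (hω_meas (n + 1))).aestronglyMeasurable
  have h2 : ∫ x, factor (ℓ (n + 1)) (ω (n + 1) x) t ∂P = 1 := by
    rw [← integral_factor (hℓ_pos (n + 1)) (hℓ_lt (n + 1)) t, ← hω_unif (n + 1),
      integral_map (hω_meas (n + 1)).aemeasurable hVm.aestronglyMeasurable]
  rw [h2, mul_one, integral_indicator (hle _ hA)] at h1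
  rw [← h1, ← integral_indicator (hle _ hA)]
  refine integral_congr_ae (Eventually.of_forall fun x => ?_)
  by_cases hx : x ∈ A
  · simp only [Set.indicator_of_mem hx]
    exact Finset.prod_range_succ _ _
  · simp only [Set.indicator_of_notMem hx, zero_mul]

variable [IsProbabilityMeasure P]

theorem setIntegral_pairing (hω_meas : ∀ n, Measurable (ω n)) (f : C(UnitAddCircle, ℝ)) (n : ℕ)
    (A : Set Ω) :
    ∫ x in A, pairing ℓ f n (fun k => ω k x) ∂P
      = ∫ t, f t * ∫ x in A, density ℓ (fun k => ω k x) n t ∂P := by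
  have hi : Integrable (Function.uncurry fun (x : Ω) (t : UnitAddCircle) =>
      f t * density ℓ (fun k => ω k x) n t) ((P.restrict A).prod volume) := by
    refine Integrable.of_bound (C := ‖f‖ * ∏ k ∈ Finset.range n, |1 - ℓ k|⁻¹) ?_
      (Eventually.of_forall fun p => abs_mul_density_le ℓ f n _ _)
    exact ((f.continuous.measurable.comp measurable_snd).mul
      (measurable_path_density hω_meas n)).aestronglyMeasurable
  unfold pairing
  rw [integral_integral_swap hi]
  exact integral_congr_ae (Eventually.of_forall fun t => integral_const_mul _ _)

theorem martingale_pairing (hω_meas : ∀ n, Measurable (ω n)) (hω_indep : iIndepFun ω P)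
    (hω_unif : ∀ n, P.map (ω n) = volume) (hℓ_pos : ∀ n, 0 < ℓ n) (hℓ_lt : ∀ n, ℓ n < 1)
    (f : C(UnitAddCircle, ℝ)) :
    Martingale (fun n x => pairing ℓ f (n + 1) fun k => ω k x) (endpointFiltration hω_meas) P := by
  refine martingale_of_setIntegral_eq_succ
    (fun n => (measurable_pairing_succ hω_meas f n).stronglyMeasurable) (fun n => ?_)
    fun n A hA => ?_
  · exact Integrable.of_bound ((measurable_pairing ℓ f (n + 1)).comp
      (measurable_path hω_meas)).aestronglyMeasurable _
      (Eventually.of_forall fun x => abs_pairing_le ℓ f (n + 1) _)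
  · rw [setIntegral_pairing hω_meas, setIntegral_pairing hω_meas]
    refine integral_congr_ae (Eventually.of_forall fun t => ?_)
    simp only [setIntegral_density_succ hω_meas hω_indep hω_unif hℓ_pos hℓ_lt n t hA]

theorem eLpNorm_pairing_le (hω_meas : ∀ n, Measurable (ω n)) (hω_indep : iIndepFun ω P)
    (hω_unif : ∀ n, P.map (ω n) = volume) (hℓ_pos : ∀ n, 0 < ℓ n) (hℓ_lt : ∀ n, ℓ n < 1)
    (f : C(UnitAddCircle, ℝ)) (n : ℕ) :
    eLpNorm (fun x => pairing ℓ f n fun k => ω k x) 1 P ≤ ‖f‖₊ := by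
  rw [eLpNorm_one_eq_lintegral_enorm]
  calc ∫⁻ x, ‖pairing ℓ f n fun k => ω k x‖ₑ ∂P
      ≤ ∫⁻ x, (∫⁻ t : UnitAddCircle,
          ‖f‖₊ * ENNReal.ofReal (density ℓ (fun k => ω k x) n t)) ∂P := by
        refine lintegral_mono fun x => (enorm_integral_le_lintegral_enorm _).trans ?_
        refine lintegral_mono fun t => ?_
        rw [enorm_mul, Real.enorm_of_nonneg (density_nonneg hℓ_lt _ _ _)]
        gcongr
        exact enorm_le_coe.2 (f.norm_coe_le_norm t)
    _ = ∫⁻ t : UnitAddCircle, ∫⁻ x, ‖f‖₊ * ENNReal.ofReal (density ℓ (fun k => ω k x) n t) ∂P := by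
        refine lintegral_lintegral_swap ?_
        exact ((measurable_path_density hω_meas n).ennreal_ofReal.const_mul _).aemeasurable
    _ = ‖f‖₊ := by
        have h : ∀ t : UnitAddCircle, ∫⁻ x, ‖f‖₊ * ENNReal.ofReal (density ℓ (fun k => ω k x) n t) ∂P = ‖f‖₊ := by
          intro t
          have hm : Measurable fun x => ENNReal.ofReal (density ℓ (fun k => ω k x) n t) :=
            ((measurable_path_density hω_meas n).comp measurable_prodMk_right).ennreal_ofReal
          rw [lintegral_const_mul _ hm,
            lintegral_density_eq_one hω_meas hω_indep hω_unif hℓ_pos hℓ_lt, mul_one]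
        simp [h]

theorem ae_tendsto_partialMeasure (hω_meas : ∀ n, Measurable (ω n)) (hω_indep : iIndepFun ω P)
    (hω_unif : ∀ n, P.map (ω n) = volume) (hℓ_pos : ∀ n, 0 < ℓ n) (hℓ_lt : ∀ n, ℓ n < 1) :
    ∀ᵐ x ∂P, ∃ μ, Tendsto (fun n => partialMeasure ℓ (fun k => ω k x) n) atTop (𝓝 μ) := by
  have hconv : ∀ f : C(UnitAddCircle, ℝ), ∀ᵐ x ∂P, ∃ c,
      Tendsto (fun n => pairing ℓ f n fun k => ω k x) atTop (𝓝 c) := by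
    intro f
    filter_upwards [(martingale_pairing hω_meas hω_indep hω_unif hℓ_pos hℓ_lt
      f).submartingale.exists_ae_tendsto_of_bdd fun n =>
        eLpNorm_pairing_le hω_meas hω_indep hω_unif hℓ_pos hℓ_lt f (n + 1)] with x hx
    obtain ⟨c, hc⟩ := hx
    exact ⟨c, (tendsto_add_atTop_iff_nat 1).1 hc⟩
  -- A countable dense family gives a single exceptional null set; the test function 1 is added to
  -- control the masses.
  have hdense := ae_all_iff.2 fun j => hconv (TopologicalSpace.denseSeq C(UnitAddCircle, ℝ) j)
  filter_upwards [hdense, hconv 1] with x hx hx1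
  refine exists_tendsto_finiteMeasure (TopologicalSpace.denseRange_denseSeq C(UnitAddCircle, ℝ))
    ?_ ?_
  · obtain ⟨c, hc⟩ := hx1
    refine ⟨c, hc.congr fun n => ?_⟩
    rw [← integral_partialMeasure hℓ_lt]
    rfl
  · rintro _ ⟨j, rfl⟩
    obtain ⟨c, hc⟩ := hx j
    exact ⟨c, hc.congr fun n => (integral_partialMeasure hℓ_lt _ _ _).symm⟩

end

/-! ### An L² criterion for absolute continuity, and the density of the sum -/

/-- Only continuous test functions are used, since these pass to weak limits. A closed subset of a
`ρ`-null set is approximated by its thickened indicators, whose `ρ`-integrals tend to 0; inner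
regularity by closed sets concludes. -/
theorem absolutelyContinuous_of_sq_lintegral_le {X : Type*} [PseudoEMetricSpace X]
    [MeasurableSpace X] [BorelSpace X] {ν ρ : Measure X} [IsFiniteMeasure ν] [IsFiniteMeasure ρ]
    {C : ℝ≥0∞} (hC : C ≠ ∞)
    (h : ∀ g : X → ℝ≥0, Continuous g → (∀ x, g x ≤ 1) →
      (∫⁻ x, g x ∂ν) ^ 2 ≤ C * ∫⁻ x, g x ∂ρ) : ν ≪ ρ := by
  refine Measure.AbsolutelyContinuous.mk fun A hA h0 => ?_
  rw [hA.measure_eq_iSup_isClosed_of_ne_top (measure_ne_top ν A)]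
  simp only [ENNReal.iSup_eq_zero]
  intro K hKA hK
  have hK0 : ρ K = 0 := measure_mono_null hKA h0
  have hδ : ∀ n : ℕ, (0 : ℝ) < 1 / (n + 1) := fun n => by positivity
  have hlim := tendsto_lintegral_thickenedIndicator_of_isClosed ρ hK hδ
    tendsto_one_div_add_atTop_nhds_zero_nat
  have hlim2 := ENNReal.Tendsto.const_mul (a := C) hlim (Or.inr hC)
  rw [hK0, mul_zero] at hlim2
  have hle : ν K ^ 2 ≤ 0 := by
    refine ge_of_tendsto' hlim2 fun n => ?_
    refine le_trans ?_ (h _ (thickenedIndicator (hδ n) K).continuous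
      (thickenedIndicator_le_one (hδ n) K))
    gcongr
    exact measure_le_lintegral_thickenedIndicator ν hK.measurableSet (hδ n)
  exact pow_eq_zero_iff two_ne_zero |>.1 (le_antisymm hle zero_le)

theorem sq_lintegral_mul_le {X : Type*} [MeasurableSpace X] (μ : Measure X) {f g : X → ℝ≥0∞}
    (hf : AEMeasurable f μ) (hg : AEMeasurable g μ) :
    (∫⁻ x, f x * g x ∂μ) ^ 2 ≤ (∫⁻ x, f x ^ 2 ∂μ) * ∫⁻ x, g x ^ 2 ∂μ := by
  have h := ENNReal.lintegral_mul_le_Lp_mul_Lq μ Real.HolderConjugate.two_two hf hg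
  simp only [Pi.mul_apply, ENNReal.rpow_two] at h
  refine (pow_le_pow_left' h 2).trans (le_of_eq ?_)
  rw [mul_pow, ← ENNReal.rpow_natCast, ← ENNReal.rpow_natCast, ← ENNReal.rpow_mul,
    ← ENNReal.rpow_mul]
  norm_num

/-- The tuple of `d + 1` points on the circle with sum `x` whose last `d` points are `u`. -/
def tupleOfSum {d : ℕ} (x : UnitAddCircle) (u : Fin d → UnitAddCircle) : Fin (d + 1) → UnitAddCircle :=
  Fin.cons (x - ∑ i, u i) u

theorem sum_tupleOfSum {d : ℕ} (x : UnitAddCircle) (u : Fin d → UnitAddCircle) :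
    ∑ i, tupleOfSum x u i = x := by
  simp [tupleOfSum, Fin.sum_univ_succ]

theorem measurable_tupleOfSum {d : ℕ} :
    Measurable fun p : UnitAddCircle × (Fin d → UnitAddCircle) => tupleOfSum p.1 p.2 := by
  refine measurable_pi_lambda _ fun i => ?_
  refine Fin.cases ?_ (fun j => ?_) i
  · simp only [tupleOfSum, Fin.cons_zero]
    exact measurable_fst.sub (Finset.measurable_fun_sum _ fun j _ =>
      (measurable_pi_apply j).comp measurable_snd)
  · simp only [tupleOfSum, Fin.cons_succ]
    exact (measurable_pi_apply j).comp measurable_snd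

/-- For fixed last coordinates `u`, translation invariance allows replacing the first coordinate y
by x - ∑ u, so that x becomes the sum. -/
theorem lintegral_eq_lintegral_tupleOfSum {d : ℕ} {G : (Fin (d + 1) → UnitAddCircle) → ℝ≥0∞}
    (hG : Measurable G) :
    ∫⁻ t, G t = ∫⁻ x, ∫⁻ u : Fin d → UnitAddCircle, G (tupleOfSum x u) := by
  set e := MeasurableEquiv.piFinSuccAbove (fun _ : Fin (d + 1) => UnitAddCircle) 0 with he
  have h := (volume_preserving_piFinSuccAbove (fun _ : Fin (d + 1) => UnitAddCircle) 0).symm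
  have hGe : Measurable fun p => G (e.symm p) := hG.comp e.symm.measurable
  have hcons : ∀ y u, e.symm (y, u) = (Fin.cons y u : Fin (d + 1) → UnitAddCircle) := fun y u => by
    rw [he]
    exact Fin.insertNth_zero' y u
  rw [← h.lintegral_comp hG]
  change ∫⁻ p, G (e.symm p) ∂(volume.prod volume) = _
  rw [lintegral_prod_symm _ hGe.aemeasurable]
  calc ∫⁻ u : Fin d → UnitAddCircle, ∫⁻ y : UnitAddCircle, G (e.symm (y, u))
      = ∫⁻ u : Fin d → UnitAddCircle, ∫⁻ x : UnitAddCircle, G (tupleOfSum x u) := by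
        refine lintegral_congr fun u => ?_
        rw [← lintegral_sub_right_eq_self (fun y => G (e.symm (y, u))) (∑ i, u i)]
        exact lintegral_congr fun x => by rw [hcons]; rfl
    _ = _ := by
        refine lintegral_lintegral_swap ?_
        exact ((hG.comp measurable_tupleOfSum).comp measurable_swap).aemeasurable

section
variable {Ω : Type*} [MeasurableSpace Ω] {P : Measure Ω} [IsProbabilityMeasure P]
  {ω : ℕ → Ω → UnitAddCircle} {ℓ : ℕ → ℝ}

/-- The density at `x` of the law of the sum of `d + 1` points under the product of the measures
`partialMeasure ℓ w n` weighted by `F`. -/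
noncomputable def sumDensity (ℓ : ℕ → ℝ) {d : ℕ} (F : (Fin (d + 1) → UnitAddCircle) → ℝ≥0∞) (n : ℕ)
    (w : ℕ → UnitAddCircle) (x : UnitAddCircle) : ℝ≥0∞ :=
  ∫⁻ u : Fin d → UnitAddCircle, F (tupleOfSum x u)
    * ∏ i, ENNReal.ofReal (density ℓ w n (tupleOfSum x u i))

theorem measurable_prod_density {ι : Type*} [Fintype ι] (ℓ : ℕ → ℝ) (n : ℕ) :
    Measurable fun p : (ℕ → UnitAddCircle) × (ι → UnitAddCircle) =>
      ∏ i, ENNReal.ofReal (density ℓ p.1 n (p.2 i)) := by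
  refine Finset.measurable_fun_prod _ fun i _ => Measurable.ennreal_ofReal ?_
  have h : Measurable fun p : (ℕ → UnitAddCircle) × (ι → UnitAddCircle) => (p.1, p.2 i) :=
    measurable_fst.prodMk ((measurable_pi_apply i).comp measurable_snd)
  have h2 := (measurable_density ℓ n).comp h
  exact h2

theorem measurable_weight_mul_prod_density {ι : Type*} [Fintype ι]
    {F : (ι → UnitAddCircle) → ℝ≥0∞} (hF : Measurable F) (ℓ : ℕ → ℝ) (n : ℕ) :
    Measurable fun p : (ℕ → UnitAddCircle) × (ι → UnitAddCircle) =>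
      F p.2 * ∏ i, ENNReal.ofReal (density ℓ p.1 n (p.2 i)) :=
  (hF.comp measurable_snd).mul (measurable_prod_density ℓ n)

theorem measurable_sumDensity {d : ℕ} {F : (Fin (d + 1) → UnitAddCircle) → ℝ≥0∞}
    (hF : Measurable F) (ℓ : ℕ → ℝ) (n : ℕ) :
    Measurable fun p : (ℕ → UnitAddCircle) × UnitAddCircle => sumDensity ℓ F n p.1 p.2 := by
  have h : Measurable fun q : ((ℕ → UnitAddCircle) × UnitAddCircle) × (Fin d → UnitAddCircle) =>
      (q.1.1, tupleOfSum q.1.2 q.2) :=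
    (measurable_fst.comp measurable_fst).prodMk
      (measurable_tupleOfSum.comp ((measurable_snd.comp measurable_fst).prodMk measurable_snd))
  have h2 := (measurable_weight_mul_prod_density hF ℓ n).comp h
  exact h2.lintegral_prod_right' (ν := volume)

theorem lintegral_mul_sumDensity {d : ℕ} {F : (Fin (d + 1) → UnitAddCircle) → ℝ≥0∞}
    (hF : Measurable F) (ℓ : ℕ → ℝ) (n : ℕ) (w : ℕ → UnitAddCircle) {g : UnitAddCircle → ℝ≥0∞}
    (hg : Measurable g) :
    ∫⁻ t, g (∑ i, t i) * F t
        ∂Measure.pi (fun _ : Fin (d + 1) => (partialMeasure ℓ w n : Measure UnitAddCircle))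
      = ∫⁻ x, g x * sumDensity ℓ F n w x := by
  have hs : Measurable fun t : Fin (d + 1) → UnitAddCircle => g (∑ i, t i) :=
    hg.comp (Finset.measurable_fun_sum _ fun i _ => measurable_pi_apply i)
  have hW : Measurable fun t : Fin (d + 1) → UnitAddCircle =>
      F t * ∏ i, ENNReal.ofReal (density ℓ w n (t i)) :=
    (measurable_weight_mul_prod_density hF ℓ n).comp measurable_prodMk_left
  have hsF : Measurable fun t : Fin (d + 1) → UnitAddCircle => g (∑ i, t i) * F t := hs.mul hF
  have hsW : Measurable fun t : Fin (d + 1) → UnitAddCircle =>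
      g (∑ i, t i) * (F t * ∏ i, ENNReal.ofReal (density ℓ w n (t i))) := hs.mul hW
  rw [lintegral_pi_partialMeasure ℓ w n hsF]
  simp_rw [mul_assoc]
  rw [lintegral_eq_lintegral_tupleOfSum hsW]
  refine lintegral_congr fun x => ?_
  simp_rw [sum_tupleOfSum]
  refine lintegral_const_mul _ ?_
  exact hW.comp (measurable_tupleOfSum.comp measurable_prodMk_left)

/-- Expanding the square yields two tuples with the same sum y. After Tonelli the bound depends only
on u - u', and integrating out y and a translation costs nothing because the torus has total mass 1.
-/
theorem lintegral_sq_lintegral_tupleOfSum_le {d : ℕ}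
    {W : Ω → (Fin (d + 1) → UnitAddCircle) → ℝ≥0∞}
    (hW : Measurable fun p : Ω × (Fin (d + 1) → UnitAddCircle) => W p.1 p.2)
    {Φ : (Fin d → UnitAddCircle) → ℝ≥0∞} (hΦ : Measurable Φ)
    (hcov : ∀ (y : UnitAddCircle) (u u' : Fin d → UnitAddCircle),
      ∫⁻ x, W x (tupleOfSum y u) * W x (tupleOfSum y u') ∂P ≤ Φ (u - u')) :
    ∫⁻ x, (∫⁻ y, (∫⁻ u : Fin d → UnitAddCircle, W x (tupleOfSum y u)) ^ 2) ∂P ≤ ∫⁻ u, Φ u := by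
  have hpair : Measurable fun q : Ω × UnitAddCircle × (Fin d → UnitAddCircle) ×
      (Fin d → UnitAddCircle) =>
      W q.1 (tupleOfSum q.2.1 q.2.2.1) * W q.1 (tupleOfSum q.2.1 q.2.2.2) := by
    have h1 : Measurable fun q : Ω × UnitAddCircle × (Fin d → UnitAddCircle) ×
        (Fin d → UnitAddCircle) => (q.1, tupleOfSum q.2.1 q.2.2.1) :=
      measurable_fst.prodMk (measurable_tupleOfSum.comp
        (f := fun q : Ω × UnitAddCircle × (Fin d → UnitAddCircle) ×
        (Fin d → UnitAddCircle) => (q.2.1, q.2.2.1)) (by fun_prop))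
    have h2 : Measurable fun q : Ω × UnitAddCircle × (Fin d → UnitAddCircle) ×
        (Fin d → UnitAddCircle) => (q.1, tupleOfSum q.2.1 q.2.2.2) :=
      measurable_fst.prodMk (measurable_tupleOfSum.comp
        (f := fun q : Ω × UnitAddCircle × (Fin d → UnitAddCircle) ×
        (Fin d → UnitAddCircle) => (q.2.1, q.2.2.2)) (by fun_prop))
    exact (hW.comp h1).mul (hW.comp h2)
  have hsq : ∀ x, ∫⁻ y, (∫⁻ u : Fin d → UnitAddCircle, W x (tupleOfSum y u)) ^ 2
      = ∫⁻ q : UnitAddCircle × (Fin d → UnitAddCircle) × (Fin d → UnitAddCircle),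
        W x (tupleOfSum q.1 q.2.1) * W x (tupleOfSum q.1 q.2.2) := by
    intro x
    have hm : Measurable fun q : UnitAddCircle × (Fin d → UnitAddCircle) × (Fin d → UnitAddCircle) =>
        W x (tupleOfSum q.1 q.2.1) * W x (tupleOfSum q.1 q.2.2) := hpair.comp measurable_prodMk_left
    change _ = ∫⁻ q, _ ∂(volume.prod (volume.prod volume))
    rw [lintegral_prod _ hm.aemeasurable]
    refine lintegral_congr fun y => ?_
    have hWy : Measurable fun u : Fin d → UnitAddCircle => W x (tupleOfSum y u) :=
      hW.comp (measurable_const.prodMk (measurable_tupleOfSum.comp measurable_prodMk_left))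
    rw [lintegral_prod_mul hWy.aemeasurable hWy.aemeasurable, ← sq]
  simp_rw [hsq]
  rw [lintegral_lintegral_swap hpair.aemeasurable]
  have hm : Measurable fun q : UnitAddCircle × (Fin d → UnitAddCircle) ×
      (Fin d → UnitAddCircle) => Φ (q.2.1 - q.2.2) := hΦ.comp (by fun_prop)
  have hm2 : Measurable fun q : (Fin d → UnitAddCircle) ×
      (Fin d → UnitAddCircle) => Φ (q.1 - q.2) := hΦ.comp (by fun_prop)
  calc ∫⁻ q : UnitAddCircle × (Fin d → UnitAddCircle) × (Fin d → UnitAddCircle),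
        (∫⁻ x, W x (tupleOfSum q.1 q.2.1) * W x (tupleOfSum q.1 q.2.2) ∂P)
      ≤ ∫⁻ q : UnitAddCircle × (Fin d → UnitAddCircle) × (Fin d → UnitAddCircle),
          Φ (q.2.1 - q.2.2) := lintegral_mono fun q => hcov _ _ _
    _ = ∫⁻ u, Φ u := by
        change ∫⁻ q, _ ∂(volume.prod (volume.prod volume)) = _
        have hconst : ∫⁻ _ : UnitAddCircle, ∫⁻ q : (Fin d → UnitAddCircle) × (Fin d → UnitAddCircle),
            Φ (q.1 - q.2) ∂(volume.prod volume)
            = ∫⁻ q : (Fin d → UnitAddCircle) × (Fin d → UnitAddCircle),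
              Φ (q.1 - q.2) ∂(volume.prod volume) := by
          rw [lintegral_const, UnitAddCircle.measure_univ, mul_one]
        refine (lintegral_prod _ hm.aemeasurable).trans (hconst.trans ?_)
        have hshift : ∀ u : Fin d → UnitAddCircle, ∫⁻ u', Φ (u' - u) = ∫⁻ u', Φ u' := fun u =>
          lintegral_sub_right_eq_self Φ u
        refine (lintegral_prod_symm _ hm2.aemeasurable).trans ((lintegral_congr hshift).trans ?_)
        rw [lintegral_const, measure_univ, mul_one]

theorem measurable_prod_kernel (ℓ : ℕ → ℝ) (d : ℕ) :
    Measurable fun u : Fin d → UnitAddCircle => (∏ i, kernel ℓ (u i)) * kernel ℓ (-∑ i, u i) := by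
  refine Measurable.mul (Finset.measurable_fun_prod _ fun i _ =>
    (measurable_kernel ℓ).comp (measurable_pi_apply i)) ((measurable_kernel ℓ).comp ?_)
  exact (Finset.measurable_fun_sum _ fun i _ => measurable_pi_apply i).neg

theorem lintegral_sq_sumDensity_le (hω_meas : ∀ n, Measurable (ω n)) {d : ℕ}
    {F : (Fin (d + 1) → UnitAddCircle) → ℝ≥0∞} (hF : Measurable F) (n : ℕ) {C : ℝ≥0∞}
    (hC : ∀ t s : Fin (d + 1) → UnitAddCircle,
      F t * F s * ∫⁻ x, ∏ i, (ENNReal.ofReal (density ℓ (fun k => ω k x) n (t i))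
        * ENNReal.ofReal (density ℓ (fun k => ω k x) n (s i))) ∂P
      ≤ C * ∏ i, kernel ℓ (t i - s i)) :
    ∫⁻ x, (∫⁻ y, sumDensity ℓ F n (fun k => ω k x) y ^ 2) ∂P
      ≤ C * ∫⁻ u : Fin d → UnitAddCircle, (∏ i, kernel ℓ (u i)) * kernel ℓ (-∑ i, u i) := by
  have hW : Measurable fun p : Ω × (Fin (d + 1) → UnitAddCircle) =>
      F p.2 * ∏ i, ENNReal.ofReal (density ℓ (fun k => ω k p.1) n (p.2 i)) := by
    have h : Measurable fun p : Ω × (Fin (d + 1) → UnitAddCircle) =>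
        ((fun k => ω k p.1 : ℕ → UnitAddCircle), p.2) :=
      Measurable.prodMk (measurable_pi_lambda _ fun k => (hω_meas k).comp measurable_fst)
        measurable_snd
    have h2 := (measurable_weight_mul_prod_density hF ℓ n).comp h
    exact h2
  rw [← lintegral_const_mul _ (measurable_prod_kernel ℓ d)]
  refine lintegral_sq_lintegral_tupleOfSum_le
    (W := fun x t => F t * ∏ i, ENNReal.ofReal (density ℓ (fun k => ω k x) n (t i))) hW
    ((measurable_prod_kernel ℓ d).const_mul C) fun y u u' => ?_
  have hD : ∀ t, Measurable fun x => ENNReal.ofReal (density ℓ (fun k => ω k x) n t) := fun t =>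
    ((measurable_path_density hω_meas n).comp measurable_prodMk_right).ennreal_ofReal
  have hm : Measurable fun x =>
      ∏ i, (ENNReal.ofReal (density ℓ (fun k => ω k x) n (tupleOfSum y u i))
        * ENNReal.ofReal (density ℓ (fun k => ω k x) n (tupleOfSum y u' i))) :=
    Finset.measurable_fun_prod _ fun i _ => (hD _).mul (hD _)
  have h1 : ∀ x, (F (tupleOfSum y u)
        * ∏ i, ENNReal.ofReal (density ℓ (fun k => ω k x) n (tupleOfSum y u i)))
      * (F (tupleOfSum y u')
        * ∏ i, ENNReal.ofReal (density ℓ (fun k => ω k x) n (tupleOfSum y u' i)))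
      = F (tupleOfSum y u) * F (tupleOfSum y u') *
        ∏ i, (ENNReal.ofReal (density ℓ (fun k => ω k x) n (tupleOfSum y u i))
        * ENNReal.ofReal (density ℓ (fun k => ω k x) n (tupleOfSum y u' i))) := by
    intro x
    rw [Finset.prod_mul_distrib]
    exact mul_mul_mul_comm _ _ _ _
  simp_rw [h1]
  rw [lintegral_const_mul _ hm]
  refine (hC _ _).trans (le_of_eq ?_)
  -- Equal sums force the first coordinates to differ by minus the sum of the other differences;
  -- this is where the factor K(-∑ t_i) of the hypothesis comes from.
  have h0 : tupleOfSum y u 0 - tupleOfSum y u' 0 = -∑ i, (u - u') i := by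
    simp only [tupleOfSum, Fin.cons_zero, Pi.sub_apply, Finset.sum_sub_distrib]
    abel
  rw [Fin.prod_univ_succ, mul_comm (kernel ℓ _), h0]
  rfl

end

/-! ### Absolute continuity of the law of the sum on one box -/

section
variable {Ω : Type*} [MeasurableSpace Ω] {P : Measure Ω} [IsProbabilityMeasure P]
  {ω : ℕ → Ω → UnitAddCircle} {ℓ : ℕ → ℝ}

theorem absolutelyContinuous_map_sum_withDensity {d : ℕ} (ℓ : ℕ → ℝ) (w : ℕ → UnitAddCircle)
    {μ : FiniteMeasure UnitAddCircle} (hμ : Tendsto (partialMeasure ℓ w) atTop (𝓝 μ))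
    {F : (Fin (d + 1) → UnitAddCircle) → ℝ≥0} (hF : Continuous F) (hF1 : ∀ t, F t ≤ 1)
    (hlim : liminf (fun n => ∫⁻ y, sumDensity ℓ (fun t => (F t : ℝ≥0∞)) n w y ^ 2) atTop < ∞) :
    (((Measure.pi fun _ : Fin (d + 1) => (μ : Measure UnitAddCircle)).withDensity
      fun t => (F t : ℝ≥0∞)).map fun t => ∑ i, t i) ≪ (volume : Measure UnitAddCircle) := by
  have hFm : Measurable fun t => (F t : ℝ≥0∞) := hF.measurable.coe_nnreal_ennreal
  have hsum : Measurable fun t : Fin (d + 1) → UnitAddCircle => ∑ i, t i :=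
    Finset.measurable_fun_sum _ fun i _ => measurable_pi_apply i
  have hfin : IsFiniteMeasure ((Measure.pi fun _ : Fin (d + 1) =>
      (μ : Measure UnitAddCircle)).withDensity fun t => (F t : ℝ≥0∞)) := by
    refine isFiniteMeasure_withDensity (ne_top_of_le_ne_top (measure_ne_top
      (Measure.pi fun _ : Fin (d + 1) => (μ : Measure UnitAddCircle)) Set.univ) ?_)
    rw [← lintegral_one]
    exact lintegral_mono fun t => ENNReal.coe_le_one_iff.2 (hF1 t)
  -- A finite liminf bounds the L² norms along infinitely many `n`, which is enough because the left
  -- side converges.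
  obtain ⟨C, hC1, hC2⟩ := exists_between hlim
  refine absolutelyContinuous_of_sq_lintegral_le hC2.ne fun g hg hg1 => ?_
  have hgm : Measurable fun x => (g x : ℝ≥0∞) := hg.measurable.coe_nnreal_ennreal
  have hgs : Measurable fun t : Fin (d + 1) → UnitAddCircle => (g (∑ i, t i) : ℝ≥0∞) :=
    hgm.comp hsum
  rw [lintegral_map hgm hsum, lintegral_withDensity_eq_lintegral_mul _ hFm hgs]
  have hconv := tendsto_lintegral_pi hμ (F := fun t : Fin (d + 1) → UnitAddCircle =>
    g (∑ i, t i) * F t) (by fun_prop)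
  have hconv2 := (ENNReal.continuous_pow 2).continuousAt.tendsto.comp hconv
  have hle : (∫⁻ t, ((g (∑ i, t i) * F t : ℝ≥0) : ℝ≥0∞)
      ∂Measure.pi fun _ : Fin (d + 1) => (μ : Measure UnitAddCircle)) ^ 2 ≤ C * ∫⁻ x, g x := by
    refine le_of_tendsto_of_frequently hconv2 ((frequently_lt_of_liminf_lt (by isBoundedDefault)
      hC1).mono fun n hn => ?_)
    simp only [Function.comp_apply, ENNReal.coe_mul]
    rw [lintegral_mul_sumDensity hFm ℓ n w hgm]
    have hsm : Measurable fun x => sumDensity ℓ (fun t => (F t : ℝ≥0∞)) n w x :=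
      (measurable_sumDensity hFm ℓ n).comp measurable_prodMk_left
    refine (sq_lintegral_mul_le volume hgm.aemeasurable hsm.aemeasurable).trans ?_
    rw [mul_comm]
    refine mul_le_mul' hn.le (lintegral_mono fun x => ?_)
    rw [sq]
    exact mul_le_of_le_one_right' (ENNReal.coe_le_one_iff.2 (hg1 x))
  refine le_trans (le_of_eq ?_) hle
  congr 2
  funext t
  rw [Pi.mul_apply, ENNReal.coe_mul, mul_comm]

/-- A continuous weight on tuples of points which is positive exactly on the product of the balls of
radius `ε` around the points `c i`. -/
noncomputable def boxWeight {ι : Type*} [Fintype ι] (c : ι → UnitAddCircle) (ε : ℝ)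
    (t : ι → UnitAddCircle) : ℝ≥0 :=
  ∏ i, (ε - dist (t i) (c i)).toNNReal

theorem continuous_boxWeight {ι : Type*} [Fintype ι] (c : ι → UnitAddCircle) (ε : ℝ) :
    Continuous (boxWeight c ε) := by
  unfold boxWeight
  fun_prop

theorem boxWeight_le_one {ι : Type*} [Fintype ι] (c : ι → UnitAddCircle) {ε : ℝ} (hε : ε ≤ 1)
    (t : ι → UnitAddCircle) : boxWeight c ε t ≤ 1 := by
  refine Finset.prod_le_one' fun i _ => ?_
  rw [Real.toNNReal_le_one]
  linarith [dist_nonneg (x := t i) (y := c i)]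

theorem boxWeight_ne_zero_iff {ι : Type*} [Fintype ι] (c : ι → UnitAddCircle) (ε : ℝ)
    (t : ι → UnitAddCircle) : boxWeight c ε t ≠ 0 ↔ ∀ i, t i ∈ Metric.ball (c i) ε := by
  simp [boxWeight, Finset.prod_ne_zero_iff]

/-- The moment bound is uniform in n, so Fatou makes the liminf of ∫ h_n² almost surely finite.
Outside the box the weight vanishes, so the bound is needed only for tuples inside it. -/
theorem ae_absolutelyContinuous_map_sum_box (hω_meas : ∀ n, Measurable (ω n))
    (hω_indep : iIndepFun ω P) (hω_unif : ∀ n, P.map (ω n) = volume)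
    (hℓ_pos : ∀ n, 0 < ℓ n) (hℓ_lt : ∀ n, ℓ n < 1) (hℓ_zero : Tendsto ℓ atTop (𝓝 0))
    (hsq : Summable fun n => ℓ n ^ 2) {d : ℕ}
    (hK : ∫⁻ t : Fin d → UnitAddCircle, (∏ i, kernel ℓ (t i)) * kernel ℓ (-∑ i, t i) < ∞)
    {ε : ℝ} (hε : 0 < ε) (hε1 : ε ≤ 1) {c : Fin (d + 1) → UnitAddCircle}
    (hc : Pairwise fun i j => 4 * ε ≤ dist (c i) (c j)) :
    ∀ᵐ x ∂P, ∀ μ : FiniteMeasure UnitAddCircle,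
      Tendsto (partialMeasure ℓ fun k => ω k x) atTop (𝓝 μ) →
      (((Measure.pi fun _ : Fin (d + 1) => (μ : Measure UnitAddCircle)).withDensity
        fun t => (boxWeight c ε t : ℝ≥0∞)).map fun t => ∑ i, t i)
        ≪ (volume : Measure UnitAddCircle) := by
  obtain ⟨C, hC⟩ := exists_lintegral_prod_density_le hω_meas hω_indep hω_unif hℓ_pos hℓ_lt hℓ_zero
    hsq hε hc
  have hFm : Measurable fun t => (boxWeight c ε t : ℝ≥0∞) :=
    (continuous_boxWeight c ε).measurable.coe_nnreal_ennreal
  have hbound : ∀ n, ∫⁻ x, (∫⁻ y, sumDensity ℓ (fun t => (boxWeight c ε t : ℝ≥0∞)) n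
      (fun k => ω k x) y ^ 2) ∂P ≤ C * ∫⁻ u : Fin d → UnitAddCircle,
        (∏ i, kernel ℓ (u i)) * kernel ℓ (-∑ i, u i) := by
    intro n
    refine lintegral_sq_sumDensity_le hω_meas hFm n fun t s => ?_
    by_cases ht : boxWeight c ε t = 0
    · simp [ht]
    by_cases hs : boxWeight c ε s = 0
    · simp [hs]
    refine le_trans ?_ (hC n t s ((boxWeight_ne_zero_iff c ε t).1 ht)
      ((boxWeight_ne_zero_iff c ε s).1 hs))
    refine mul_le_of_le_one_left' (mul_le_one' ?_ ?_)
    · exact ENNReal.coe_le_one_iff.2 (boxWeight_le_one c hε1 t)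
    · exact ENNReal.coe_le_one_iff.2 (boxWeight_le_one c hε1 s)
  have hmeas : ∀ n, Measurable fun x => ∫⁻ y, sumDensity ℓ (fun t => (boxWeight c ε t : ℝ≥0∞)) n
      (fun k => ω k x) y ^ 2 := by
    intro n
    have h1 : Measurable fun w : ℕ → UnitAddCircle =>
        ∫⁻ y, sumDensity ℓ (fun t => (boxWeight c ε t : ℝ≥0∞)) n w y ^ 2 :=
      ((measurable_sumDensity hFm ℓ n).pow_const 2).lintegral_prod_right' (ν := volume)
    exact h1.comp (measurable_path hω_meas)
  have hfin : ∫⁻ x, liminf (fun n => ∫⁻ y, sumDensity ℓ (fun t => (boxWeight c ε t : ℝ≥0∞)) n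
      (fun k => ω k x) y ^ 2) atTop ∂P ≠ ∞ := by
    refine ne_top_of_le_ne_top (ENNReal.mul_ne_top (ENNReal.coe_ne_top (r := C)) hK.ne)
      ((lintegral_liminf_le hmeas).trans ?_)
    exact (liminf_le_liminf (Eventually.of_forall hbound)).trans (liminf_const _).le
  filter_upwards [ae_lt_top (Measurable.liminf hmeas) hfin] with x hx μ hμ
  exact absolutelyContinuous_map_sum_withDensity ℓ _ hμ (continuous_boxWeight c ε)
    (boxWeight_le_one c hε1) hx

/-! ### Absence of atoms -/

theorem lintegral_fin_two_sub {Φ : UnitAddCircle → ℝ≥0∞} (hΦ : Measurable Φ) :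
    ∫⁻ t : Fin 2 → UnitAddCircle, Φ (t 0 - t 1) = ∫⁻ u, Φ u := by
  have hm : Measurable fun p : UnitAddCircle × UnitAddCircle => Φ (p.1 - p.2) :=
    hΦ.comp (measurable_fst.sub measurable_snd)
  have h := (volume_preserving_finTwoArrow UnitAddCircle).lintegral_comp hm
  refine h.trans ?_
  have hshift : ∀ u : UnitAddCircle, ∫⁻ u', Φ (u - u') = ∫⁻ u', Φ u' := fun u =>
    lintegral_sub_left_eq_self Φ u
  refine (lintegral_prod _ hm.aemeasurable).trans ((lintegral_congr hshift).trans ?_)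
  rw [lintegral_const, UnitAddCircle.measure_univ, mul_one]

theorem volume_singleton_zero : volume ({0} : Set UnitAddCircle) = 0 := by
  rw [← Metric.closedBall_zero, AddCircle.volume_closedBall]
  simp

theorem lintegral_lintegral_sub_le (hω_meas : ∀ n, Measurable (ω n)) {C : ℝ≥0} {n : ℕ}
    (hC : ∀ t s : UnitAddCircle, ∫⁻ x, ENNReal.ofReal (density ℓ (fun k => ω k x) n t)
        * ENNReal.ofReal (density ℓ (fun k => ω k x) n s) ∂P ≤ C * kernel ℓ (t - s))
    {ψ : UnitAddCircle → ℝ≥0∞} (hψ : Measurable ψ) :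
    ∫⁻ x, (∫⁻ t, ψ (t 0 - t 1) ∂Measure.pi fun _ : Fin 2 =>
      (partialMeasure ℓ (fun k => ω k x) n : Measure UnitAddCircle)) ∂P
      ≤ C * ∫⁻ u, ψ u ∂(volume.withDensity (kernel ℓ)) := by
  have hsub : Measurable fun t : Fin 2 → UnitAddCircle => ψ (t 0 - t 1) :=
    hψ.comp ((measurable_pi_apply 0).sub (measurable_pi_apply 1))
  simp_rw [lintegral_pi_partialMeasure ℓ _ n hsub]
  have hm : Measurable fun p : Ω × (Fin 2 → UnitAddCircle) =>
      ψ (p.2 0 - p.2 1) * ∏ i, ENNReal.ofReal (density ℓ (fun k => ω k p.1) n (p.2 i)) := by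
    have h : Measurable fun p : Ω × (Fin 2 → UnitAddCircle) =>
        ((fun k => ω k p.1 : ℕ → UnitAddCircle), p.2) :=
      Measurable.prodMk (measurable_pi_lambda _ fun k => (hω_meas k).comp measurable_fst)
        measurable_snd
    have h2 := (measurable_weight_mul_prod_density hsub ℓ n).comp h
    exact h2
  rw [lintegral_lintegral_swap hm.aemeasurable]
  have hψK : Measurable fun u => (C : ℝ≥0∞) * (kernel ℓ u * ψ u) :=
    ((measurable_kernel ℓ).mul hψ).const_mul _
  calc ∫⁻ t : Fin 2 → UnitAddCircle, (∫⁻ x, ψ (t 0 - t 1)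
        * ∏ i, ENNReal.ofReal (density ℓ (fun k => ω k x) n (t i)) ∂P)
      ≤ ∫⁻ t : Fin 2 → UnitAddCircle, C * (kernel ℓ (t 0 - t 1) * ψ (t 0 - t 1)) := by
        refine lintegral_mono fun t => ?_
        have hD : ∀ t, Measurable fun x => ENNReal.ofReal (density ℓ (fun k => ω k x) n t) :=
          fun t => ((measurable_path_density hω_meas n).comp measurable_prodMk_right).ennreal_ofReal
        simp_rw [Fin.prod_univ_two]
        have hDD : Measurable fun x => ENNReal.ofReal (density ℓ (fun k => ω k x) n (t 0))
            * ENNReal.ofReal (density ℓ (fun k => ω k x) n (t 1)) := (hD _).mul (hD _)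
        rw [lintegral_const_mul _ hDD, ← mul_assoc, mul_comm]
        exact mul_le_mul_left (hC _ _) _
    _ = ∫⁻ u, C * (kernel ℓ u * ψ u) := lintegral_fin_two_sub hψK
    _ = C * ∫⁻ u, ψ u ∂(volume.withDensity (kernel ℓ)) := by
        have hKψ : Measurable fun u => kernel ℓ u * ψ u := (measurable_kernel ℓ).mul hψ
        rw [lintegral_const_mul _ hKψ,
          lintegral_withDensity_eq_lintegral_mul _ (measurable_kernel ℓ) hψ]
        rfl

/-- For cutoffs ψ_j decreasing to the indicator of {0}, μ{y}² ≤ ∬ ψ_j(t - s) dμ dμ, and the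
expectation of the right side is at most C ∫ ψ_j K by Fatou. This tends to 0, since K is integrable
and {0} is Lebesgue null. -/
theorem ae_measure_singleton_eq_zero (hω_meas : ∀ n, Measurable (ω n))
    (hω_indep : iIndepFun ω P) (hω_unif : ∀ n, P.map (ω n) = volume)
    (hℓ_pos : ∀ n, 0 < ℓ n) (hℓ_lt : ∀ n, ℓ n < 1) (hℓ_zero : Tendsto ℓ atTop (𝓝 0))
    (hsq : Summable fun n => ℓ n ^ 2) (hK : ∫⁻ t, kernel ℓ t ≠ ∞) :
    ∀ᵐ x ∂P, ∀ μ : FiniteMeasure UnitAddCircle,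
      Tendsto (partialMeasure ℓ fun k => ω k x) atTop (𝓝 μ) →
      ∀ y, (μ : Measure UnitAddCircle) {y} = 0 := by
  -- With a single index, separation is vacuous, and the unit ball is the whole circle because
  -- distances are at most 1/2: the bound holds for all t and s.
  obtain ⟨C, hC⟩ := exists_lintegral_prod_density_le hω_meas hω_indep hω_unif hℓ_pos hℓ_lt hℓ_zero
    hsq (ι := Unit) one_pos (c := fun _ => 0) (fun i j h => absurd (Subsingleton.elim i j) h)
  have hball : ∀ t : UnitAddCircle, t ∈ Metric.ball (0 : UnitAddCircle) 1 := fun t => by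
    rw [mem_ball_zero_iff]
    refine (AddCircle.norm_le_half_period (1 : ℝ) one_ne_zero).trans_lt ?_
    norm_num
  have hC' : ∀ n (t s : UnitAddCircle), ∫⁻ x, ENNReal.ofReal (density ℓ (fun k => ω k x) n t)
        * ENNReal.ofReal (density ℓ (fun k => ω k x) n s) ∂P ≤ C * kernel ℓ (t - s) := by
    intro n t s
    simpa using hC n (fun _ => t) (fun _ => s) (fun _ => hball t) (fun _ => hball s)
  have hδ : ∀ n : ℕ, (0 : ℝ) < 1 / (n + 1) := fun n => by positivity
  have hfin : IsFiniteMeasure ((volume : Measure UnitAddCircle).withDensity (kernel ℓ)) :=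
    isFiniteMeasure_withDensity hK
  have hlim := tendsto_lintegral_thickenedIndicator_of_isClosed
    ((volume : Measure UnitAddCircle).withDensity (kernel ℓ)) (isClosed_singleton (x := 0)) hδ
    tendsto_one_div_add_atTop_nhds_zero_nat
  rw [withDensity_absolutelyContinuous _ _ volume_singleton_zero] at hlim
  have hlim2 := ENNReal.Tendsto.const_mul (a := (C : ℝ≥0∞)) hlim (Or.inr ENNReal.coe_ne_top)
  rw [mul_zero] at hlim2
  set Y : ℕ → ℕ → Ω → ℝ≥0∞ := fun j n x =>
    ∫⁻ t, (thickenedIndicator (hδ j) ({0} : Set UnitAddCircle) (t 0 - t 1) : ℝ≥0∞)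
      ∂Measure.pi fun _ : Fin 2 =>
        (partialMeasure ℓ (fun k => ω k x) n : Measure UnitAddCircle) with hY
  have hψm : ∀ j, Measurable fun u : UnitAddCircle =>
      (thickenedIndicator (hδ j) ({0} : Set UnitAddCircle) u : ℝ≥0∞) := fun j =>
    (thickenedIndicator (hδ j) _).continuous.measurable.coe_nnreal_ennreal
  have hYm : ∀ j n, Measurable (Y j n) := by
    intro j n
    have hsub : Measurable fun t : Fin 2 → UnitAddCircle =>
        (thickenedIndicator (hδ j) ({0} : Set UnitAddCircle) (t 0 - t 1) : ℝ≥0∞) :=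
      (hψm j).comp ((measurable_pi_apply 0).sub (measurable_pi_apply 1))
    have h1 : Measurable fun w : ℕ → UnitAddCircle => ∫⁻ t : Fin 2 → UnitAddCircle,
        (thickenedIndicator (hδ j) ({0} : Set UnitAddCircle) (t 0 - t 1) : ℝ≥0∞)
          * ∏ i, ENNReal.ofReal (density ℓ w n (t i)) :=
      (measurable_weight_mul_prod_density hsub ℓ n).lintegral_prod_right' (ν := volume)
    simp only [hY]
    simp_rw [lintegral_pi_partialMeasure ℓ _ n hsub]
    exact h1.comp (measurable_path hω_meas)
  have hYle : ∀ j, ∫⁻ x, liminf (fun n => Y j n x) atTop ∂P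
      ≤ C * ∫⁻ u, (thickenedIndicator (hδ j) ({0} : Set UnitAddCircle) u : ℝ≥0∞)
        ∂(volume.withDensity (kernel ℓ)) := fun j =>
    (lintegral_liminf_le (hYm j)).trans ((liminf_le_liminf (Eventually.of_forall fun n =>
      lintegral_lintegral_sub_le hω_meas (hC' n) (hψm j))).trans (liminf_const _).le)
  have hinf : ∫⁻ x, ⨅ j, liminf (fun n => Y j n x) atTop ∂P = 0 := by
    refine le_antisymm (ge_of_tendsto' hlim2 fun j => ?_) zero_le
    exact (lintegral_mono fun x => iInf_le _ j).trans (hYle j)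
  rw [lintegral_eq_zero_iff (Measurable.iInf fun j => Measurable.liminf (hYm j))] at hinf
  filter_upwards [hinf] with x hx μ hμ y
  have hle : (μ : Measure UnitAddCircle) {y} ^ 2 ≤ 0 := by
    rw [← show (⨅ j, liminf (fun n => Y j n x) atTop) = 0 from hx]
    refine le_iInf fun j => ?_
    have hconv := tendsto_lintegral_pi hμ (F := fun t : Fin 2 → UnitAddCircle =>
      thickenedIndicator (hδ j) ({0} : Set UnitAddCircle) (t 0 - t 1))
      ((thickenedIndicator (hδ j) ({0} : Set UnitAddCircle)).continuous.comp (by fun_prop))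
    rw [show liminf (fun n => Y j n x) atTop = _ from hconv.liminf_eq]
    calc (μ : Measure UnitAddCircle) {y} ^ 2
        = Measure.pi (fun _ : Fin 2 => (μ : Measure UnitAddCircle)) (Set.univ.pi fun _ => {y}) := by
          rw [Measure.pi_pi, Finset.prod_const, Finset.card_univ, Fintype.card_fin]
      _ = ∫⁻ t in Set.univ.pi fun _ => {y}, 1
            ∂Measure.pi (fun _ : Fin 2 => (μ : Measure UnitAddCircle)) := (setLIntegral_one _).symm
      _ ≤ ∫⁻ t in Set.univ.pi fun _ => {y},
            (thickenedIndicator (hδ j) ({0} : Set UnitAddCircle) (t 0 - t 1) : ℝ≥0∞)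
            ∂Measure.pi (fun _ : Fin 2 => (μ : Measure UnitAddCircle)) := by
          refine setLIntegral_mono' (MeasurableSet.univ_pi fun _ => measurableSet_singleton y)
            fun t ht => ?_
          have h0 : t 0 = y := ht 0 trivial
          have h1 : t 1 = y := ht 1 trivial
          rw [h0, h1, sub_self, thickenedIndicator_one (hδ j) _ (Set.mem_singleton _)]
          simp
      _ ≤ _ := setLIntegral_le_lintegral _ _
  exact pow_eq_zero_iff two_ne_zero |>.1 (le_antisymm hle zero_le)

end

/-! ### Convolution powers as laws of sums, and the covering by boxes -/

theorem measurable_sum_coords (d : ℕ) : Measurable fun t : Fin d → UnitAddCircle => ∑ i, t i :=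
  Finset.measurable_fun_sum _ fun i _ => measurable_pi_apply i

theorem iteratedConv_eq_map_sum (μ : Measure UnitAddCircle) [IsFiniteMeasure μ] (d : ℕ) :
    iteratedConv μ d = (Measure.pi fun _ : Fin (d + 1) => μ).map fun t => ∑ i, t i := by
  induction d with
  | zero =>
    refine Eq.trans ?_ (congrArg (fun f => (Measure.pi fun _ : Fin 1 => μ).map f)
      (funext fun t => (Fin.sum_univ_one t).symm))
    exact (measurePreserving_funUnique μ (Fin 1)).map_eq.symm
  | succ d ih =>
    have he := (measurePreserving_piFinSuccAbove (fun _ : Fin (d + 2) => μ) 0).map_eq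
    have hsum : (fun t : Fin (d + 2) → UnitAddCircle => ∑ i, t i)
        = (fun p : UnitAddCircle × UnitAddCircle => p.1 + p.2) ∘
          (Prod.map id fun u : Fin (d + 1) → UnitAddCircle => ∑ i, u i) ∘
          MeasurableEquiv.piFinSuccAbove (fun _ : Fin (d + 2) => UnitAddCircle) 0 := by
      funext t
      exact Fin.sum_univ_succ t
    have hm : Measurable (Prod.map id fun u : Fin (d + 1) → UnitAddCircle => ∑ i, u i :
        UnitAddCircle × (Fin (d + 1) → UnitAddCircle) → UnitAddCircle × UnitAddCircle) :=
      measurable_id.prodMap (measurable_sum_coords _)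
    have hfin : IsFiniteMeasure (iteratedConv μ d) := by rw [ih]; infer_instance
    rw [hsum, ← Measure.map_map measurable_add (hm.comp (MeasurableEquiv.measurable _)),
      ← Measure.map_map hm (MeasurableEquiv.measurable _), he,
      ← Measure.map_prod_map _ _ measurable_id (measurable_sum_coords _), Measure.map_id, ← ih]
    -- Splitting off coordinate 0 puts the new factor on the left, while `iteratedConv` has it on
    -- the right.
    exact Measure.conv_comm _ _

/-- By Fubini: once t_i is fixed, t_j is confined to a single point. -/
theorem measure_pi_eq_coords (μ : Measure UnitAddCircle) [IsFiniteMeasure μ]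
    (hμ : ∀ y, μ {y} = 0) {d : ℕ} {i j : Fin (d + 1)} (hij : i ≠ j) :
    (Measure.pi fun _ : Fin (d + 1) => μ) {t | t i = t j} = 0 := by
  obtain ⟨k, rfl⟩ := Fin.exists_succAbove_eq hij.symm
  have : NullSingletonClass μ := ⟨hμ⟩
  have h := measurePreserving_piFinSuccAbove (fun _ : Fin (d + 1) => μ) i
  have hm : MeasurableSet {p : UnitAddCircle × (Fin d → UnitAddCircle) | p.1 = p.2 k} :=
    measurableSet_eq_fun measurable_fst ((measurable_pi_apply k).comp measurable_snd)
  have h2 := h.measure_preimage hm.nullMeasurableSet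
  refine h2.trans ?_
  rw [Measure.measure_prod_null hm]
  refine Eventually.of_forall fun y => ?_
  refine Eq.trans (congrArg _ ?_) (Measure.pi_hyperplane (fun _ : Fin d => μ) k y)
  ext u
  exact eq_comm

theorem exists_box_of_injective {ι : Type*} [Fintype ι] {t : ι → UnitAddCircle}
    (ht : Function.Injective t) :
    ∃ (j : ℕ) (q : ι → ℕ), (Pairwise fun i i' => 4 * (1 / ((j : ℝ) + 1)) ≤
      dist (TopologicalSpace.denseSeq UnitAddCircle (q i)) (TopologicalSpace.denseSeq UnitAddCircle (q i')))
      ∧ ∀ i, t i ∈ Metric.ball (TopologicalSpace.denseSeq UnitAddCircle (q i)) (1 / ((j : ℝ) + 1)) := by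
  -- The margin 6 leaves 4 after each of the two points is moved by less than one radius to its
  -- center.
  have hev : ∀ i i', i ≠ i' → ∀ᶠ j : ℕ in atTop, 6 * (1 / ((j : ℝ) + 1)) < dist (t i) (t i') := by
    intro i i' h
    have hlim := (tendsto_one_div_add_atTop_nhds_zero_nat (𝕜 := ℝ)).const_mul 6
    rw [mul_zero] at hlim
    exact hlim.eventually_lt_const (dist_pos.2 (ht.ne h))
  obtain ⟨j, hj⟩ := (eventually_all.2 fun i => eventually_all.2 fun i' =>
    eventually_imp_distrib_left.2 (hev i i')).exists
  have hpos : (0 : ℝ) < 1 / ((j : ℝ) + 1) := by positivity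
  choose q hq using fun i => (TopologicalSpace.denseRange_denseSeq UnitAddCircle).exists_dist_lt
    (t i) hpos
  refine ⟨j, q, fun i i' h => ?_, hq⟩
  have h1 := hj i i' h
  have h2 := dist_triangle4 (t i) (TopologicalSpace.denseSeq UnitAddCircle (q i))
    (TopologicalSpace.denseSeq UnitAddCircle (q i')) (t i')
  have h3 := hq i
  have h4 := hq i'
  rw [dist_comm] at h4
  linarith

/-- Tuples with a repeated coordinate are null, and the others lie in boxes with centers in a dense
sequence and radii 1/(j+1). There are countably many such boxes, and positivity of the weight on
each transfers null sets from the weighted measure to the product measure. -/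
theorem iteratedConv_absolutelyContinuous {μ : Measure UnitAddCircle} [IsFiniteMeasure μ]
    (hμ : ∀ y, μ {y} = 0) {d : ℕ}
    (hbox : ∀ (j : ℕ) (q : Fin (d + 1) → ℕ),
      (Pairwise fun i i' => 4 * (1 / ((j : ℝ) + 1)) ≤ dist
        (TopologicalSpace.denseSeq UnitAddCircle (q i)) (TopologicalSpace.denseSeq UnitAddCircle (q i'))) →
      (((Measure.pi fun _ : Fin (d + 1) => μ).withDensity fun t =>
        (boxWeight (fun i => TopologicalSpace.denseSeq UnitAddCircle (q i)) (1 / ((j : ℝ) + 1)) t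
          : ℝ≥0∞)).map fun t => ∑ i, t i) ≪ (volume : Measure UnitAddCircle)) :
    iteratedConv μ d ≪ (volume : Measure UnitAddCircle) := by
  rw [iteratedConv_eq_map_sum]
  refine Measure.AbsolutelyContinuous.mk fun A hA h0 => ?_
  have hS := measurable_sum_coords (d + 1)
  rw [Measure.map_apply hS hA]
  have hnull : ∀ (j : ℕ) (q : Fin (d + 1) → ℕ),
      (Pairwise fun i i' => 4 * (1 / ((j : ℝ) + 1)) ≤ dist
        (TopologicalSpace.denseSeq UnitAddCircle (q i)) (TopologicalSpace.denseSeq UnitAddCircle (q i'))) →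
      (Measure.pi fun _ : Fin (d + 1) => μ) {t | ∑ i, t i ∈ A ∧
        boxWeight (fun i => TopologicalSpace.denseSeq UnitAddCircle (q i)) (1 / ((j : ℝ) + 1)) t ≠ 0}
        = 0 := by
    intro j q hq
    have h := hbox j q hq h0
    have hFm : Measurable fun t => (boxWeight
        (fun i => TopologicalSpace.denseSeq UnitAddCircle (q i)) (1 / ((j : ℝ) + 1)) t : ℝ≥0∞) :=
      (continuous_boxWeight _ _).measurable.coe_nnreal_ennreal
    rw [Measure.map_apply hS hA, withDensity_apply_eq_zero hFm] at h
    refine measure_mono_null (fun t ht => ?_) h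
    exact ⟨ENNReal.coe_ne_zero.2 ht.2, ht.1⟩
  have hcover : (fun t : Fin (d + 1) → UnitAddCircle => ∑ i, t i) ⁻¹' A ⊆
      (⋃ (i : Fin (d + 1)) (i' : Fin (d + 1)) (_ : i ≠ i'), {t | t i = t i'}) ∪
      ⋃ (j : ℕ) (q : Fin (d + 1) → ℕ) (_ : Pairwise fun i i' => 4 * (1 / ((j : ℝ) + 1)) ≤ dist
        (TopologicalSpace.denseSeq UnitAddCircle (q i)) (TopologicalSpace.denseSeq UnitAddCircle (q i'))),
        {t | ∑ i, t i ∈ A ∧ boxWeight (fun i => TopologicalSpace.denseSeq UnitAddCircle (q i))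
          (1 / ((j : ℝ) + 1)) t ≠ 0} := by
    intro t htA
    by_cases ht : Function.Injective t
    · obtain ⟨j, q, hq, htq⟩ := exists_box_of_injective ht
      refine Or.inr (Set.mem_iUnion.2 ⟨j, Set.mem_iUnion.2 ⟨q, Set.mem_iUnion.2 ⟨hq, htA, ?_⟩⟩⟩)
      exact (boxWeight_ne_zero_iff _ _ _).2 htq
    · simp only [Function.Injective, not_forall] at ht
      obtain ⟨i, i', h1, h2⟩ := ht
      exact Or.inl (Set.mem_iUnion.2 ⟨i, Set.mem_iUnion.2 ⟨i', Set.mem_iUnion.2 ⟨h2, h1⟩⟩⟩)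
  refine measure_mono_null hcover (measure_union_null ?_ ?_)
  · exact measure_iUnion_null fun i => measure_iUnion_null fun i' => measure_iUnion_null fun h =>
      measure_pi_eq_coords μ hμ h
  · exact measure_iUnion_null fun j => measure_iUnion_null fun q => measure_iUnion_null fun h =>
      hnull j q h

/-- As K ≥ 1, every factor but one can be dropped from the integrand; d ≥ 1 guarantees that one
remains. -/
theorem lintegral_kernel_ne_top {ℓ : ℕ → ℝ} {d : ℕ} (hd : 1 ≤ d)
    (hK : ∫⁻ t : Fin d → UnitAddCircle, (∏ i, kernel ℓ (t i)) * kernel ℓ (-∑ i, t i) < ∞) :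
    ∫⁻ t, kernel ℓ t ≠ ∞ := by
  refine ne_top_of_le_ne_top hK.ne ?_
  rw [← (measurePreserving_eval (fun _ : Fin d => (volume : Measure UnitAddCircle))
    ⟨0, hd⟩).lintegral_comp
    (measurable_kernel ℓ)]
  refine lintegral_mono fun t => ?_
  calc kernel ℓ (t ⟨0, hd⟩) ≤ ∏ i, kernel ℓ (t i) :=
        Finset.single_le_prod' (f := fun i => kernel ℓ (t i)) (fun i _ => one_le_kernel ℓ _)
          (Finset.mem_univ _)
    _ ≤ _ := le_mul_of_one_le_right' (one_le_kernel ℓ _)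

end DvoretzkyCovering

theorem theorem1 {Ω : Type*} [MeasurableSpace Ω] (P : Measure Ω) [IsProbabilityMeasure P]
    -- `ω n` and `ℓ n` are the left endpoint and the length of the `(n + 1)`-st covering arc
    (ω : ℕ → Ω → UnitAddCircle) (hω_meas : ∀ n, Measurable (ω n))
    (hω_indep : iIndepFun ω P) (hω_unif : ∀ n, P.map (ω n) = volume)
    (ℓ : ℕ → ℝ) (hℓ_pos : ∀ n, 0 < ℓ n) (hℓ_lt : ∀ n, ℓ n < 1)
    (hℓ_anti : Antitone ℓ) (hℓ_zero : Tendsto ℓ atTop (𝓝 0))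
    (hA : Tendsto (fun n => ∑ k ∈ Finset.range n, ℓ k) atTop atTop)
    (hB : Summable fun n =>
      (ℓ n - ℓ (n + 1)) * Real.exp (∑ k ∈ Finset.range (n + 1), ℓ k))
    (d : ℕ) (hd : 1 ≤ d)
    (hK : ∫⁻ t : Fin d → UnitAddCircle,
      (∏ i, DvoretzkyCovering.kernel ℓ (t i)) *
        DvoretzkyCovering.kernel ℓ (-∑ i, t i) < ∞) :
    ∀ᵐ x ∂P,
      Tendsto (fun n => DvoretzkyCovering.partialMeasure ℓ (fun k => ω k x) n) atTop
        (𝓝 (DvoretzkyCovering.dvoretzkyMeasure ℓ (fun k => ω k x))) ∧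
      DvoretzkyCovering.iteratedConv
          (DvoretzkyCovering.dvoretzkyMeasure ℓ (fun k => ω k x) : Measure UnitAddCircle) d ≪
        (volume : Measure UnitAddCircle) := by
  have hsq := DvoretzkyCovering.summable_sq_of_summable_sub_mul_exp hℓ_pos hℓ_anti hℓ_zero hB
  -- Only countably many boxes are involved, so one almost sure event serves them all.
  have hbox : ∀ᵐ x ∂P, ∀ (j : ℕ) (q : Fin (d + 1) → ℕ), (Pairwise fun i i' =>
      4 * (1 / ((j : ℝ) + 1)) ≤ dist (TopologicalSpace.denseSeq UnitAddCircle (q i))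
        (TopologicalSpace.denseSeq UnitAddCircle (q i'))) → _ :=
    ae_all_iff.2 fun j => ae_all_iff.2 fun q => eventually_imp_distrib_left.2 fun hq =>
      DvoretzkyCovering.ae_absolutelyContinuous_map_sum_box hω_meas hω_indep hω_unif hℓ_pos hℓ_lt
        hℓ_zero hsq hK (by positivity) ((div_le_one (by positivity)).2 (by simp)) hq
  filter_upwards [DvoretzkyCovering.ae_tendsto_partialMeasure hω_meas hω_indep hω_unif hℓ_pos hℓ_lt,
    DvoretzkyCovering.ae_measure_singleton_eq_zero hω_meas hω_indep hω_unif hℓ_pos hℓ_lt hℓ_zero hsq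
      (DvoretzkyCovering.lintegral_kernel_ne_top hd hK), hbox] with x hconv hatom hbox
  have hlim := tendsto_nhds_limUnder hconv
  exact ⟨hlim, DvoretzkyCovering.iteratedConv_absolutelyContinuous (hatom _ hlim)
    fun j q hq => hbox j q hq _ hlim⟩
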